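/- Let $p$ be a prime, let $\ell\ge 2$ be an even integer, put $q=p^\ell$, and let $F$ be the finite field with $q$ elements. Let $\delta$ be a real number with $0<\delta<1-q^{-1}$ and $h_q(\delta)<\tfrac14$, where $$h_q(\delta)=\delta\log_q(q-1)-\delta\log_q\delta-(1-\delta)\log_q(1-\delta)$$ is the $q$-entropy function. For an integer $n>1$ let $\mathcal R_n=F[X]/\langle X^n-1\rangle$; identify $\mathcal R_n$ with $F^n$ through $\sum_{i=0}^{n-1}a_iX^i\leftrightarrow(a_0,\dots,a_{n-1})$, and $\mathcal R_n\times\mathcal R_n$ with $F^n\times F^n=F^{2n}$ componentwise. For $a=\sum_{i=0}^{n-1}a_iX^i\in\mathcal R_n$ put $a^*=\sum_{i=0}^{n-1}a_i^{p^{\ell/2}}X^{(n-1)i}\in\mathcal R_n$, and for $g\in\mathcal R_n$ let $C_{1,g}\subseteq F^{2n}$ be the code corresponding to the $\mathcal R_n$-submodule of $\mathcal R_n\times\mathcal R_n$ generated by $(1,g)$. A linear code $C\subseteq F^n\times F^n$ is called $2$-quasi-cyclic if $(c_0,\dots,c_{n-1},c'_0,\dots,c'_{n-1})\in C$ implies $(c_{n-1},c_0,\dots,c_{n-2},c'_{n-1},c'_0,\dots,c'_{n-2})\in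 C$. It is called Hermitian self-dual if $C=\{a\in F^{2n} : \sum_{j} c_j a_j^{p^{\ell/2}}=0 \text{ for all } c\in C\}$. Its rate is $\mathrm R(C)=\dim_F C/(2n)$, and its relative minimum distance is $\Delta(C)=d(C)/(2n)$, where $d(C)$ is the minimum Hamming distance between distinct codewords of $C$. Then there are integers $n_i>1$ coprime to $q$ and elements $g_i\in\mathcal R_{n_i}$ with $g_ig_i^*=-1$ $(i=1,2,\dots)$ such that $2n_i\to\infty$ as $i\to\infty$ and, for every $i$, the code $C_i=C_{1,g_i}$ of length $2n_i$ is a Hermitian self-dual $2$-quasi-cyclic code over $F$, with $\mathrm R(C_i)=\tfrac12$ and $\Delta(C_i)>\delta$. -/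

import Mathlib

open Polynomial

/-- The `q`-entropy function
`h_q(δ) = δ log_q (q-1) - δ log_q δ - (1-δ) log_q (1-δ)`. -/
noncomputable def qEntropy (q : ℕ) (δ : ℝ) : ℝ :=
  δ * Real.logb q (q - 1) - δ * Real.logb q δ - (1 - δ) * Real.logb q (1 - δ)

section Codes

variable {F : Type*} [Field F] {ι : Type*} [Fintype ι]

/-- The minimum distance of a code: the least Hamming distance of two distinct codewords. -/
noncomputable def minDistance [DecidableEq F] (C : Submodule F (ι → F)) : ℕ :=
  sInf {d | ∃ c ∈ C, ∃ c' ∈ C, c ≠ c' ∧ hammingDist c c' = d}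

/-- The relative minimum distance `Δ(C)`: minimum distance divided by code length. -/
noncomputable def relMinDistance [DecidableEq F] (C : Submodule F (ι → F)) : ℝ :=
  (minDistance C : ℝ) / (Fintype.card ι : ℝ)

/-- The rate `R(C)`: dimension divided by code length. -/
noncomputable def codeRate (C : Submodule F (ι → F)) : ℝ :=
  (Module.finrank F C : ℝ) / (Fintype.card ι : ℝ)

/-- The Galois `p^h`-inner product `∑ aᵢ bᵢ^(p^h)`. -/
def galoisInner (p h : ℕ) (a b : ι → F) : F :=
  ∑ i, a i * b i ^ p ^ h

/-- The Galois `p^h`-dual code of `C`. -/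
def galoisDual (p h : ℕ) (C : Submodule F (ι → F)) : Set (ι → F) :=
  {a | ∀ c ∈ C, galoisInner p h c a = 0}

/-- `C` is Galois `p^h`-self-dual. -/
def IsGaloisSelfDual (p h : ℕ) (C : Submodule F (ι → F)) : Prop :=
  (C : Set (ι → F)) = galoisDual p h C

/-- A code over the field with `p^l` elements, `l` even, is Hermitian self-dual if it is Galois
`p^(l/2)`-self-dual. -/
def IsHermitianSelfDual (p l : ℕ) (C : Submodule F (ι → F)) : Prop :=
  IsGaloisSelfDual p (l / 2) C

/-- The double cyclic permutation
`(c₀, …, cₙ₋₁, c'₀, …, c'ₙ₋₁) ↦ (cₙ₋₁, c₀, …, cₙ₋₂, c'ₙ₋₁, c'₀, …, c'ₙ₋₂)` on `F^n × F^n`, whose words are indexed by `Fin n ⊕ Fin n`. -/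
def doubleShift {n : ℕ} (c : Fin n ⊕ Fin n → F) : Fin n ⊕ Fin n → F :=
  Sum.elim (fun i => c (Sum.inl ((finRotate n).symm i)))
    (fun i => c (Sum.inr ((finRotate n).symm i)))

/-- A linear code in `F^n × F^n` is 2-quasi-cyclic if it is invariant under the double cyclic
permutation. -/
def IsTwoQuasiCyclic {n : ℕ} (C : Submodule F (Fin n ⊕ Fin n → F)) : Prop :=
  ∀ c ∈ C, doubleShift c ∈ C

end Codes

section CyclicAlgebra

/-- The algebra `F[X] / (X^n - 1)`. -/
abbrev CycAlg (F : Type*) [Field F] (n : ℕ) : Type _ :=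
  AdjoinRoot (X ^ n - 1 : F[X])

variable {F : Type*} [Field F]

/-- The class of `X` in `F[X] / (X^n - 1)`. -/
noncomputable abbrev CycAlg.x (F : Type*) [Field F] (n : ℕ) : CycAlg F n :=
  AdjoinRoot.root (X ^ n - 1 : F[X])

theorem CycAlg.x_pow (n : ℕ) : CycAlg.x F n ^ n = 1 := by
  have h : AdjoinRoot.mk (X ^ n - 1 : F[X]) (X ^ n - 1) = 0 := AdjoinRoot.mk_self
  rw [map_sub, map_pow, map_one, AdjoinRoot.mk_X] at h
  exact sub_eq_zero.mp h

/-- The identification `(a₀, …, aₙ₋₁) ↦ a₀ + a₁ X + ⋯ + aₙ₋₁ X^(n-1)` of `F^n` with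
`F[X] / (X^n - 1)` (bijective for `n ≥ 1`). -/
noncomputable def wordToCyc (F : Type*) [Field F] (n : ℕ) : (Fin n → F) →ₗ[F] CycAlg F n :=
  Fintype.linearCombination F (fun i : Fin n => CycAlg.x F n ^ (i : ℕ))

/-- The identification of `F^n × F^n` with the square of `F[X] / (X^n - 1)`, componentwise. -/
noncomputable def wordToCycPair (F : Type*) [Field F] (n : ℕ) :
    (Fin n ⊕ Fin n → F) →ₗ[F] CycAlg F n × CycAlg F n :=
  (wordToCyc F n ∘ₗ LinearMap.funLeft F F Sum.inl).prod
    (wordToCyc F n ∘ₗ LinearMap.funLeft F F Sum.inr)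

/-- The code `C_{a,b}` in `F^n × F^n`: the words that correspond to the elements of the
`F[X] / (X^n - 1)`-submodule of `(F[X] / (X^n - 1))²` generated by `(a, b)`. -/
noncomputable def pairCode {n : ℕ} (a b : CycAlg F n) : Submodule F (Fin n ⊕ Fin n → F) :=
  ((Submodule.span (CycAlg F n) {(a, b)}).restrictScalars F).comap (wordToCycPair F n)

/-- The operator `*` on `F[X] / (X^n - 1)`, `∑ aᵢ X^i ↦ ∑ aᵢ^(p^h) X^((n-1)i)`
(see `cycStar_wordToCyc`). -/
noncomputable def cycStar (p h : ℕ) [Fact p.Prime] [CharP F p] (n : ℕ) :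
    CycAlg F n →+* CycAlg F n :=
  AdjoinRoot.lift ((AdjoinRoot.of (X ^ n - 1 : F[X])).comp (iterateFrobenius F p h))
    (CycAlg.x F n ^ (n - 1)) (by
      rw [eval₂_sub, eval₂_pow, eval₂_X, eval₂_one, ← pow_mul, mul_comm, pow_mul,
        CycAlg.x_pow, one_pow, sub_self])

theorem cycStar_wordToCyc (p h : ℕ) [Fact p.Prime] [CharP F p] (n : ℕ) (a : Fin n → F) :
    cycStar p h n (wordToCyc F n a) =
      ∑ i : Fin n, (a i ^ p ^ h) • CycAlg.x F n ^ ((n - 1) * (i : ℕ)) := by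
  simp only [wordToCyc, Fintype.linearCombination_apply, map_sum, Algebra.smul_def,
    AdjoinRoot.algebraMap_eq, map_mul, map_pow, cycStar, AdjoinRoot.lift_of, AdjoinRoot.lift_root,
    RingHom.comp_apply, iterateFrobenius_def, pow_mul]

end CyclicAlgebra

/-!
If `g * g* = -1`, then `C_{1,g}` is self-orthogonal and its dimension is half its length, so only
the minimum distance is at stake. Fix a prime `n`, let `D` be the set of all these `g`, and call a
word of relative weight at most `δ` light. The `g` in `D` for which `C_{1,g}` has a light nonzero
word `(a, a g)` are grouped by the ideal `J` generated by `a` and `a*`.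

* A cyclic code has an information set, whose cyclic shifts cover all coordinates equally often. A
  light word of `J × J` is light on one of them, so that there are at most `n |J|^(2 h(δ))` such
  words.
* For given `a` and `b`, the `g` in `D` with `a g = b` lie in one coset of the group of those units
  with `u u* = 1` that fix `J` pointwise. This group meets trivially the group of units with
  `u u* = 1` that are congruent to `1` modulo `J`, and the map `v ↦ v / v*` shows that the latter
  has at least `|J|^(1/2) / 2` elements. So there are at most `2 |D| |J|^(-1/2)` such `g`.

Each `J` thus excludes at most `2 n |D| |J|^(2 h(δ) - 1/2)` elements; the exponent is negative.
If `J` is contained in every maximal ideal other than `(X - 1)`, all entries of `a` are equal and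
`(a, a g)` has full weight. For the other `J` the sum of these bounds is less than `|D|` as soon as
the residue fields at the maximal ideals other than `(X - 1)` are large compared with `n`. They have
at least `q^t` elements, `t` the order of `q` modulo `n`, and counting the prime factors of
`∏ (q^t - 1)` for small `t` against Chebyshev's bound gives arbitrarily large primes `n` for which
`q^t` exceeds any given power of `n`.
-/

section NumberTheory

open Filter Asymptotics

theorem eventually_natCast_le_primeCounting_mul_log :
    ∀ᶠ Y : ℕ in atTop, (Y : ℝ) ≤ 4 * (Nat.primeCounting Y * Real.log Y) := by
  filter_upwards [(Real.isLittleO_log_id_atTop.comp_tendsto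
    tendsto_natCast_atTop_atTop).bound (show (0 : ℝ) < 1 / 8 by norm_num),
    eventually_ge_atTop 8] with Y hlog hY
  have hY8 : (8 : ℝ) ≤ Y := by exact_mod_cast hY
  have hlogpos : 0 < Real.log Y := Real.log_pos (by linarith)
  have hlogle : Real.log Y ≤ 1 / 8 * Y := by
    simpa [Real.norm_of_nonneg hlogpos.le] using hlog
  have hsucc : Real.log (Y + 1) ≤ Real.log Y + Real.log 2 := by
    rw [← Real.log_mul (by positivity) two_ne_zero]
    exact Real.log_le_log (by positivity) (by linarith)
  have hπ := (div_le_iff₀ hlogpos).1 (Chebyshev.pi_ge Y)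
  nlinarith [Real.log_two_gt_d9]

theorem isLittleO_log_pow_primeCounting (k : ℕ) :
    (fun Y : ℕ => Real.log Y ^ k) =o[atTop] fun Y => (Nat.primeCounting Y : ℝ) := by
  refine isLittleO_iff.2 fun c hc => ?_
  have hpow : (fun Y : ℕ => Real.log Y ^ (k + 1)) =o[atTop] fun Y => (Y : ℝ) :=
    (Real.isLittleO_pow_log_id_atTop (n := k + 1)).comp_tendsto tendsto_natCast_atTop_atTop
  filter_upwards [hpow.bound (show 0 < c / 4 by positivity), eventually_ge_atTop 2,
    eventually_natCast_le_primeCounting_mul_log] with Y hY hY2 hπ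
  have hlogpos : 0 < Real.log Y := Real.log_pos (by exact_mod_cast hY2)
  rw [Real.norm_of_nonneg (by positivity), Real.norm_of_nonneg (by positivity)] at hY ⊢
  refine le_of_mul_le_mul_right ?_ hlogpos
  calc Real.log Y ^ k * Real.log Y ≤ c / 4 * Y := by rwa [← pow_succ]
    _ ≤ c / 4 * (4 * (Nat.primeCounting Y * Real.log Y)) := by gcongr
    _ = c * Nat.primeCounting Y * Real.log Y := by ring

theorem card_primes_le_of_orderOf_lt {q T : ℕ} (hq : 2 ≤ q) {S : Finset ℕ}
    (hprime : ∀ n ∈ S, n.Prime) (hcop : ∀ n ∈ S, q.Coprime n)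
    (horder : ∀ n ∈ S, orderOf (q : ZMod n) < T) : S.card ≤ q * T ^ 2 := by
  have hdvd : ∏ n ∈ S, n ∣ ∏ t ∈ Finset.Ico 1 T, (q ^ t - 1) := by
    refine Finset.prod_primes_dvd _ (fun n hn => (hprime n hn).prime) fun n hn => ?_
    have : NeZero n := ⟨(hprime n hn).ne_zero⟩
    have hpos : 0 < orderOf (q : ZMod n) := by
      rw [← ZMod.coe_unitOfCoprime q (hcop n hn), orderOf_units]
      exact orderOf_pos _
    refine dvd_trans ?_ (Finset.dvd_prod_of_mem _ (Finset.mem_Ico.2 ⟨hpos, horder n hn⟩))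
    rw [← ZMod.natCast_eq_zero_iff, Nat.cast_sub (Nat.one_le_pow _ _ (by omega)), Nat.cast_pow,
      pow_orderOf_eq_one, Nat.cast_one, sub_self]
  have hpos : 0 < ∏ t ∈ Finset.Ico 1 T, (q ^ t - 1) := Finset.prod_pos fun t ht =>
    Nat.sub_pos_of_lt (Nat.one_lt_pow (by have := Finset.mem_Ico.1 ht; omega) (by omega))
  refine (Nat.pow_le_pow_iff_right one_lt_two).1 ?_
  calc 2 ^ S.card ≤ ∏ n ∈ S, n := Finset.pow_card_le_prod _ _ _ fun n hn => (hprime n hn).two_le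
    _ ≤ ∏ t ∈ Finset.Ico 1 T, (q ^ t - 1) := Nat.le_of_dvd hpos hdvd
    _ ≤ ∏ _t ∈ Finset.Ico 1 T, q ^ T := Finset.prod_le_prod' fun t ht =>
      (Nat.sub_le _ _).trans (Nat.pow_le_pow_right (by omega) (Finset.mem_Ico.1 ht).2.le)
    _ ≤ (q ^ T) ^ T := by
      rw [Finset.prod_const, Nat.card_Ico]
      exact Nat.pow_le_pow_right (by positivity) (Nat.sub_le _ _)
    _ ≤ ((2 ^ q) ^ T) ^ T := by gcongr; exact Nat.lt_two_pow_self.le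
    _ = 2 ^ (q * T ^ 2) := by rw [← pow_mul, ← pow_mul, sq]

theorem primeCounting_le_of_orderOf_lt {q T N Y : ℕ} (hq : 2 ≤ q) (hqN : q ≤ N)
    (horder : ∀ n, n.Prime → N < n → n ≤ Y → orderOf (q : ZMod n) < T) :
    Nat.primeCounting Y ≤ N + 1 + q * T ^ 2 := by
  have hcard : ((Finset.Ioc N Y).filter Nat.Prime).card ≤ q * T ^ 2 := by
    refine card_primes_le_of_orderOf_lt hq (fun n hn => (Finset.mem_filter.1 hn).2)
      (fun n hn => ?_) fun n hn => ?_ <;>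
    obtain ⟨hn, hprime⟩ := Finset.mem_filter.1 hn
    · exact (Nat.coprime_of_lt_prime (by omega) (hqN.trans_lt (Finset.mem_Ioc.1 hn).1)
        hprime).symm
    · exact horder n hprime (Finset.mem_Ioc.1 hn).1 (Finset.mem_Ioc.1 hn).2
  calc Nat.primeCounting Y = ((Finset.range (Y + 1)).filter Nat.Prime).card := by
        rw [Nat.primeCounting, Nat.primeCounting', Nat.count_eq_card_filter_range]
    _ ≤ (Finset.range (N + 1) ∪ (Finset.Ioc N Y).filter Nat.Prime).card := by
        refine Finset.card_le_card fun n hn => ?_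
        simp only [Finset.mem_filter, Finset.mem_range, Finset.mem_union, Finset.mem_Ioc] at hn ⊢
        rcases le_or_gt n N with hnN | hnN
        · exact Or.inl (by omega)
        · exact Or.inr ⟨⟨hnN, by omega⟩, hn.2⟩
    _ ≤ N + 1 + q * T ^ 2 := by
        grw [Finset.card_union_le, hcard, Finset.card_range]

theorem exists_prime_pow_le_pow_orderOf {q : ℕ} (hq : 2 ≤ q) (A N : ℕ) :
    ∃ n, n.Prime ∧ N < n ∧ n ^ A ≤ q ^ orderOf (q : ZMod n) := by
  by_contra! hlt
  set M := max N q
  have hπ (Y : ℕ) :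
      Nat.primeCounting Y ≤ M + 1 + q * (A * (Nat.log 2 Y + 1)) ^ 2 := by
    refine primeCounting_le_of_orderOf_lt hq (le_max_right _ _) fun n hn hMn hnY => ?_
    refine (Nat.pow_lt_pow_iff_right (by omega)).1
      ((hlt n hn ((le_max_left _ _).trans_lt hMn)).trans_le ?_)
    rw [mul_comm, pow_mul]
    refine Nat.pow_le_pow_left (hnY.trans ?_) _
    exact (Nat.lt_pow_succ_log_self one_lt_two Y).le.trans (Nat.pow_le_pow_left hq _)
  set K : ℝ := M + 1 + q * (A * 3) ^ 2
  have hK : 0 < K := by positivity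
  obtain ⟨Y, hlog, hY⟩ := (((isLittleO_log_pow_primeCounting 2).bound
    (show 0 < (2 * K)⁻¹ by positivity)).and (eventually_ge_atTop 3)).exists
  have hlogge : 1 ≤ Real.log Y := by
    rw [Real.le_log_iff_exp_le (by positivity)]
    exact Real.exp_one_lt_three.le.trans (by exact_mod_cast hY)
  have hlog₂ : (Nat.log 2 Y + 1 : ℝ) ≤ 3 * Real.log Y := by
    have hpow : (Nat.log 2 Y : ℝ) * Real.log 2 ≤ Real.log Y := by
      rw [← Real.log_pow]
      exact Real.log_le_log (by positivity) (by exact_mod_cast Nat.pow_log_le_self 2 (by omega))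
    nlinarith [Real.log_two_gt_d9]
  have hle : (Nat.primeCounting Y : ℝ) ≤ K * Real.log Y ^ 2 := by
    calc (Nat.primeCounting Y : ℝ) ≤ M + 1 + q * (A * (Nat.log 2 Y + 1)) ^ 2 := by
          exact_mod_cast hπ Y
      _ ≤ (M + 1) * Real.log Y ^ 2 + q * (A * (3 * Real.log Y)) ^ 2 := by
          gcongr
          exact le_mul_of_one_le_right (by positivity) (one_le_pow₀ hlogge)
      _ = K * Real.log Y ^ 2 := by ring
  rw [Real.norm_of_nonneg (by positivity), Real.norm_of_nonneg (by positivity),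
    inv_mul_eq_div, le_div_iff₀ (by positivity)] at hlog
  nlinarith [one_le_pow₀ hlogge (n := 2)]

end NumberTheory

section Ideals

variable {R : Type*} [CommRing R]

theorem prod_card_quotient_le_card [Finite R] {ι : Type*} [Fintype ι] {f : ι → Ideal R}
    {J : Ideal R} (hf : Pairwise (Function.onFun IsCoprime f)) (hJ : ∀ i, IsCoprime J (f i)) :
    ∏ i, Nat.card (R ⧸ f i) ≤ Nat.card J := by
  have hcoprime : IsCoprime J (⨅ i, f i) := by
    simpa using Ideal.isCoprime_biInf (s := Finset.univ) fun i _ => hJ i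
  rw [← Nat.card_pi, ← Nat.card_congr (Ideal.quotientInfRingEquivPiQuotient f hf).toEquiv]
  refine Nat.card_le_card_of_surjective (fun j : J => Ideal.Quotient.mk _ (j : R)) fun r => ?_
  obtain ⟨r, rfl⟩ := Ideal.Quotient.mk_surjective r
  obtain ⟨j, hj, k, hk, rfl⟩ := Submodule.mem_sup.1
    ((Ideal.isCoprime_iff_sup_eq.1 hcoprime).symm ▸ Submodule.mem_top (x := r))
  exact ⟨⟨j, hj⟩, by simp [Ideal.Quotient.eq_zero_iff_mem.2 hk]⟩

theorem pow_card_le_card_of_not_le [Finite R] {J : Ideal R} {B : ℕ} {S : Finset (MaximalSpectrum R)}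
    (hB : ∀ m ∈ S, B ≤ Nat.card (R ⧸ m.asIdeal)) (hJ : ∀ m ∈ S, ¬ J ≤ m.asIdeal) :
    B ^ S.card ≤ Nat.card J := by
  refine le_trans ?_ (prod_card_quotient_le_card (f := fun m : S => m.1.asIdeal)
    (fun m m' hne => Ideal.isCoprime_of_isMaximal fun h => hne (Subtype.ext
      (MaximalSpectrum.ext h))) fun m => ?_)
  · rw [Finset.prod_coe_sort S fun m => Nat.card (R ⧸ m.asIdeal)]
    exact Finset.pow_card_le_prod _ _ _ hB
  · rw [Ideal.isCoprime_iff_sup_eq, sup_comm]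
    exact m.1.isMaximal.1.2 _ (left_lt_sup.2 (hJ m m.2))

variable [IsArtinianRing R] [IsReduced R]

theorem jacobson_eq_self (J : Ideal R) : J.jacobson = J := by
  have : IsSemisimpleRing R := IsArtinianRing.isSemisimpleRing_of_isReduced R
  have : IsSemisimpleRing (R ⧸ J) :=
    (Ideal.Quotient.mk J).isSemisimpleRing_of_surjective Ideal.Quotient.mk_surjective
  rw [Ideal.jacobson_eq_iff_jacobson_quotient_eq_bot, Ideal.jacobson_bot]
  exact IsArtinianRing.isSemisimpleRing_iff_jacobson.1 this

theorem ideal_le_of_forall_maximal {I J : Ideal R}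
    (h : ∀ m : MaximalSpectrum R, J ≤ m.asIdeal → I ≤ m.asIdeal) : I ≤ J := by
  conv_rhs => rw [← jacobson_eq_self J, Ideal.jacobson]
  exact le_sInf fun m ⟨hJm, hm⟩ => h ⟨m, hm⟩ hJm

end Ideals

section Involution

variable {R : Type*} [CommRing R]

/-- The units `u` with `u * σ u = 1`. -/
def normOneUnits (σ : R →+* R) : Subgroup Rˣ :=
  (MonoidHom.id Rˣ * Units.map (σ : R →* R)).ker

/-- The units fixed by `σ`. -/
def fixedUnits (σ : R →+* R) : Subgroup Rˣ :=
  (MonoidHom.id Rˣ / Units.map (σ : R →* R)).ker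

/-- The units congruent to `1` modulo `J`. -/
def congruenceUnits (J : Ideal R) : Subgroup Rˣ :=
  (Units.map (Ideal.Quotient.mk J : R →* R ⧸ J)).ker

theorem mem_normOneUnits {σ : R →+* R} {u : Rˣ} : u ∈ normOneUnits σ ↔ (u : R) * σ u = 1 := by
  simp [normOneUnits, MonoidHom.mem_ker, Units.ext_iff]

theorem mem_fixedUnits {σ : R →+* R} {u : Rˣ} : u ∈ fixedUnits σ ↔ σ u = u := by
  rw [fixedUnits, MonoidHom.mem_ker, MonoidHom.div_apply, div_eq_one, Units.ext_iff, eq_comm]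
  rfl

theorem mem_congruenceUnits {J : Ideal R} {u : Rˣ} : u ∈ congruenceUnits J ↔ (u : R) - 1 ∈ J := by
  rw [← Ideal.Quotient.eq_zero_iff_mem, map_sub, sub_eq_zero, map_one]
  simp [congruenceUnits, MonoidHom.mem_ker, Units.ext_iff]

theorem disjoint_fixingSubgroup_congruenceUnits [IsReduced R] (J : Ideal R) :
    Disjoint (fixingSubgroup Rˣ (J : Set R)) (congruenceUnits J) := by
  refine Subgroup.disjoint_def.2 fun {u} hfix hcong => ?_
  have hu : (u : R) * (u - 1) = u - 1 :=
    (mem_fixingSubgroup_iff Rˣ).1 hfix _ (mem_congruenceUnits.1 hcong)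
  have hsq : ((u : R) - 1) ^ 2 = 0 := by linear_combination hu
  exact Units.ext (sub_eq_zero.1 (pow_eq_zero_iff two_ne_zero |>.1 hsq))

theorem card_inf_mul_card_inf_le {G : Type*} [Group G] [Finite G] (H : Subgroup G)
    {K L : Subgroup G} (hKL : Disjoint K L) :
    Nat.card ↥(H ⊓ K) * Nat.card ↥(H ⊓ L) ≤ Nat.card H := by
  rw [← Nat.card_prod]
  refine Nat.card_le_card_of_injective
    (fun x => ⟨x.1 * x.2, H.mul_mem x.1.2.1 x.2.2.1⟩) fun x y hxy => ?_
  exact Subgroup.mul_injective_of_disjoint (hKL.mono inf_le_right inf_le_right)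
    (congrArg Subtype.val hxy)

theorem card_inf_ker_mul_card_map {G G' : Type*} [Group G] [Group G'] (f : G →* G')
    (K : Subgroup G) : Nat.card ↥(K ⊓ f.ker) * Nat.card (K.map f) = Nat.card K := by
  rw [← Subgroup.relIndex_ker, ← Subgroup.inf_relIndex_left K f.ker, ← Subgroup.relIndex_bot_left,
    Subgroup.relIndex_mul_relIndex _ _ _ bot_le inf_le_left, Subgroup.relIndex_bot_left]

theorem card_congruenceUnits_le [Finite R] {σ : R →+* R} (hσ : Function.Involutive σ)
    {J : Ideal R} (hJ : J ≤ J.comap σ) :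
    Nat.card (congruenceUnits J) ≤ Nat.card ↥(congruenceUnits J ⊓ fixedUnits σ) *
      Nat.card ↥(normOneUnits σ ⊓ congruenceUnits J) := by
  rw [← card_inf_ker_mul_card_map (MonoidHom.id Rˣ / Units.map (σ : R →* R)) (congruenceUnits J)]
  refine Nat.mul_le_mul_left _ (Subgroup.card_le_of_le ?_)
  rintro _ ⟨u, hu, rfl⟩
  have hσσu : Units.map (σ : R →* R) (Units.map (σ : R →* R) u) = u :=
    Units.ext (hσ u)
  have hσu : Units.map (σ : R →* R) u ∈ congruenceUnits J :=
    mem_congruenceUnits.2 (by simpa using hJ (mem_congruenceUnits.1 hu))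
  refine ⟨MonoidHom.mem_ker.2 ?_, (congruenceUnits J).div_mem hu hσu⟩
  simp [_root_.map_div, hσσu, mul_comm u]

theorem sq_card_congruenceUnits_inf_fixedUnits_le [Finite R] {σ : R →+* R} {θ : R}
    (hθ : IsUnit (σ θ - θ)) (J : Ideal R) :
    Nat.card ↥(congruenceUnits J ⊓ fixedUnits σ) ^ 2 ≤ Nat.card J := by
  rw [sq, ← Nat.card_prod]
  refine Nat.card_le_card_of_injective
    (fun w => (⟨(w.1.1 - 1) + θ * (w.2.1 - 1), add_mem (mem_congruenceUnits.1 w.1.2.1)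
      (J.mul_mem_left θ (mem_congruenceUnits.1 w.2.2.1))⟩ : J)) ?_
  rintro ⟨⟨s, _, hs⟩, ⟨t, _, ht⟩⟩ ⟨⟨s', _, hs'⟩, ⟨t', _, ht'⟩⟩ hst
  have hval : ((s : R) - 1) + θ * (t - 1) = (s' - 1) + θ * (t' - 1) := congrArg Subtype.val hst
  have hσeq := congrArg σ hval
  simp only [map_add, map_sub, map_mul, map_one, mem_fixedUnits.1 hs, mem_fixedUnits.1 ht,
    mem_fixedUnits.1 hs', mem_fixedUnits.1 ht'] at hσeq
  have htt' : (t : R) = t' := hθ.mul_left_cancel (by linear_combination hσeq - hval)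
  have hss' : (s : R) = s' := by linear_combination hval - θ * htt'
  exact Prod.ext (Subtype.ext (Units.ext hss')) (Subtype.ext (Units.ext htt'))

theorem ncard_one_add_mem_mul_card_quotient_le [Finite R] (J m : Ideal R) :
    {w | w ∈ J ∧ 1 + w ∈ m}.ncard * Nat.card (R ⧸ m) ≤ Nat.card J := by
  rcases Set.eq_empty_or_nonempty {w | w ∈ J ∧ 1 + w ∈ m} with hempty | ⟨w₀, hw₀, hw₀m⟩
  · simp [hempty]
  rw [← Nat.card_coe_set_eq, ← Nat.card_prod]
  refine Nat.card_le_card_of_injective (fun x => (⟨x.1 + w₀ * x.2.out,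
    add_mem x.1.2.1 (J.mul_mem_right _ hw₀)⟩ : J)) ?_
  rintro ⟨⟨w, hw, hwm⟩, r⟩ ⟨⟨w', hw', hw'm⟩, r'⟩ heq
  have heq : w + w₀ * r.out = w' + w₀ * r'.out := congrArg Subtype.val heq
  have hrr' : r = r' := by
    rw [← r.out_eq, ← r'.out_eq]
    refine Ideal.Quotient.eq.2 ?_
    have hdiff : r.out - r'.out =
        (1 + w₀) * (r.out - r'.out) + ((1 + w) - (1 + w')) := by linear_combination -heq
    rw [hdiff]
    exact add_mem (m.mul_mem_right _ hw₀m) (sub_mem hwm hw'm)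
  subst hrr'
  simpa using heq

theorem card_le_two_mul_card_congruenceUnits [Finite R] [Fintype (MaximalSpectrum R)]
    (hR : ∑ m : MaximalSpectrum R, (Nat.card (R ⧸ m.asIdeal) : ℝ)⁻¹ ≤ 1 / 2) (J : Ideal R) :
    Nat.card J ≤ 2 * Nat.card (congruenceUnits J) := by
  have hcover : (J : Set R) ⊆ (fun u : Rˣ => (u : R) - 1) '' congruenceUnits J ∪
      ⋃ m : MaximalSpectrum R, {w | w ∈ J ∧ 1 + w ∈ m.asIdeal} := by
    intro w hw
    by_cases hunit : IsUnit (1 + w)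
    · obtain ⟨u, hu⟩ := hunit
      exact Or.inl ⟨u, mem_congruenceUnits.2 (by simpa [hu] using hw), by simp [hu]⟩
    · obtain ⟨m, hm, hwm⟩ := exists_max_ideal_of_mem_nonunits hunit
      exact Or.inr (Set.mem_iUnion.2 ⟨⟨m, hm⟩, hw, hwm⟩)
  have hnonunit (m : MaximalSpectrum R) : ({w | w ∈ J ∧ 1 + w ∈ m.asIdeal}.ncard : ℝ) ≤
      Nat.card J * (Nat.card (R ⧸ m.asIdeal) : ℝ)⁻¹ := by
    have : Finite (R ⧸ m.asIdeal) := .of_surjective _ Ideal.Quotient.mk_surjective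
    rw [← div_eq_mul_inv, le_div_iff₀ (by exact_mod_cast Nat.card_pos)]
    exact_mod_cast ncard_one_add_mem_mul_card_quotient_le J m.asIdeal
  have hcard : (Nat.card J : ℝ) ≤ Nat.card (congruenceUnits J) + Nat.card J * (1 / 2) := by
    calc (Nat.card J : ℝ) ≤ (((fun u : Rˣ => (u : R) - 1) '' congruenceUnits J ∪
          ⋃ m : MaximalSpectrum R, {w | w ∈ J ∧ 1 + w ∈ m.asIdeal}).ncard : ℝ) := by
          exact_mod_cast Set.ncard_le_ncard hcover
      _ ≤ Nat.card (congruenceUnits J) +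
          ∑ m : MaximalSpectrum R, ({w | w ∈ J ∧ 1 + w ∈ m.asIdeal}.ncard : ℝ) := by
          exact_mod_cast (Set.ncard_union_le _ _).trans (add_le_add
            (Set.ncard_image_le (Set.toFinite _)) (Set.ncard_iUnion_le_of_fintype _))
      _ ≤ Nat.card (congruenceUnits J) + Nat.card J * (1 / 2) := by
          grw [Finset.sum_le_sum fun m _ => hnonunit m, ← Finset.mul_sum, hR]
  exact_mod_cast (by linarith : (Nat.card J : ℝ) ≤ 2 * Nat.card (congruenceUnits J))

theorem sq_card_normOneUnits_inf_fixingSubgroup_mul_card_le [Finite R] [IsReduced R]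
    [Fintype (MaximalSpectrum R)]
    (hR : ∑ m : MaximalSpectrum R, (Nat.card (R ⧸ m.asIdeal) : ℝ)⁻¹ ≤ 1 / 2)
    {σ : R →+* R} (hσ : Function.Involutive σ) {θ : R} (hθ : IsUnit (σ θ - θ))
    {J : Ideal R} (hJ : J ≤ J.comap σ) :
    Nat.card ↥(normOneUnits σ ⊓ fixingSubgroup Rˣ (J : Set R)) ^ 2 * Nat.card J ≤
      4 * Nat.card (normOneUnits σ) ^ 2 := by
  have hdisjoint := card_inf_mul_card_inf_le (normOneUnits σ)
    (disjoint_fixingSubgroup_congruenceUnits J)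
  have hunits := card_le_two_mul_card_congruenceUnits hR J
  have hdecomp := card_congruenceUnits_le hσ hJ
  have hfixed := sq_card_congruenceUnits_inf_fixedUnits_le hθ J
  set a := Nat.card ↥(normOneUnits σ ⊓ fixingSubgroup Rˣ (J : Set R))
  set c := Nat.card ↥(normOneUnits σ ⊓ congruenceUnits J)
  set f := Nat.card ↥(congruenceUnits J ⊓ fixedUnits σ)
  refine Nat.le_of_mul_le_mul_right ?_ (Nat.card_pos (α := J))
  calc a ^ 2 * Nat.card J * Nat.card J = a ^ 2 * Nat.card J ^ 2 := by ring
    _ ≤ a ^ 2 * (2 * (f * c)) ^ 2 := by grw [hunits, hdecomp]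
    _ = 4 * (a * c) ^ 2 * f ^ 2 := by ring
    _ ≤ 4 * Nat.card (normOneUnits σ) ^ 2 * Nat.card J := by grw [hdisjoint, hfixed]

theorem isUnit_of_mul_map_eq {σ : R →+* R} {c g : R} (hc : IsUnit c) (hg : g * σ g = c) :
    IsUnit g :=
  isUnit_of_mul_isUnit_left (hg ▸ hc)

theorem card_normOneUnits_le_ncard [Finite R] {σ : R →+* R} {c g : R} (hc : IsUnit c)
    (hg : g * σ g = c) : Nat.card (normOneUnits σ) ≤ {g | g * σ g = c}.ncard := by
  rw [← Nat.card_coe_set_eq]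
  refine Nat.card_le_card_of_injective (fun u => ⟨u.1 * g, ?_⟩) fun u v huv => ?_
  · have hu := mem_normOneUnits.1 u.2
    rw [Set.mem_ofPred_eq, map_mul]
    linear_combination (g * σ g) * hu + hg
  · exact Subtype.ext (Units.ext ((isUnit_of_mul_map_eq hc hg).mul_right_cancel
      (congrArg Subtype.val huv)))

theorem mem_fixingSubgroup_span_pair {u : Rˣ} {a b : R} (ha : u * a = a) (hb : u * b = b) :
    u ∈ fixingSubgroup Rˣ (Ideal.span {a, b} : Set R) := by
  refine (mem_fixingSubgroup_iff Rˣ).2 fun y hy => ?_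
  obtain ⟨r, s, rfl⟩ := Ideal.mem_span_pair.1 hy
  rw [Units.smul_def, smul_eq_mul]
  linear_combination r * ha + s * hb

theorem ncard_mul_eq_le [Finite R] {σ : R →+* R} {c : R} (hc : IsUnit c) (a b : R) :
    {g | g * σ g = c ∧ a * g = b}.ncard ≤ Nat.card
      ↥(normOneUnits σ ⊓ fixingSubgroup Rˣ (Ideal.span {a, σ a} : Set R)) := by
  rcases Set.eq_empty_or_nonempty {g | g * σ g = c ∧ a * g = b} with hempty | ⟨g₀, hg₀, hag₀⟩
  · simp [hempty]
  obtain ⟨v, rfl⟩ := isUnit_of_mul_map_eq hc hg₀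
  have hcover : {g | g * σ g = c ∧ a * g = b} ⊆ (fun u : Rˣ => (u * v : R)) ''
      (normOneUnits σ ⊓ fixingSubgroup Rˣ (Ideal.span {a, σ a} : Set R) : Subgroup Rˣ) := by
    rintro g ⟨hg, hag⟩
    obtain ⟨w, rfl⟩ := isUnit_of_mul_map_eq hc hg
    have hσv : IsUnit (σ v) := v.isUnit.map σ
    have hσa : σ a * w = σ a * v := by
      refine hσv.mul_right_cancel ?_
      have hσ : σ a * σ w = σ a * σ v := by rw [← map_mul, ← map_mul, hag, hag₀]
      linear_combination σ a * (hg - hg₀) - w * hσ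
    have hdiv (r : R) (hr : r * w = r * v) : (w / v : Rˣ) * r = r := by
      rw [div_eq_mul_inv, Units.val_mul, mul_right_comm, mul_comm (w : R), hr,
        Units.mul_inv_cancel_right]
    refine ⟨w / v, ⟨mem_normOneUnits.2 ?_, mem_fixingSubgroup_span_pair
      (hdiv a (hag.trans hag₀.symm)) (hdiv (σ a) hσa)⟩, ?_⟩
    · refine (v.isUnit.mul hσv).mul_right_cancel ?_
      have hw : ((w / v : Rˣ) : R) * v = w := by rw [← Units.val_mul, div_mul_cancel]
      rw [one_mul, mul_mul_mul_comm, ← map_mul, hw, hg, hg₀]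
    · simp only [← Units.val_mul, div_mul_cancel]
  exact (Set.ncard_le_ncard hcover (Set.toFinite _)).trans (Set.ncard_image_le (Set.toFinite _))

theorem span_pair_le_comap {σ : R →+* R} (hσ : Function.Involutive σ) (a : R) :
    Ideal.span {a, σ a} ≤ (Ideal.span {a, σ a}).comap σ := by
  rw [Ideal.span_le, Set.pair_subset_iff]
  refine ⟨Ideal.subset_span (by simp), ?_⟩
  rw [SetLike.mem_coe, Ideal.mem_comap, hσ a]
  exact Ideal.subset_span (by simp)

theorem sq_ncard_mul_eq_mul_card_le [Finite R] [IsReduced R] [Fintype (MaximalSpectrum R)]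
    (hR : ∑ m : MaximalSpectrum R, (Nat.card (R ⧸ m.asIdeal) : ℝ)⁻¹ ≤ 1 / 2)
    {σ : R →+* R} (hσ : Function.Involutive σ) {θ : R} (hθ : IsUnit (σ θ - θ)) {c : R}
    (hc : IsUnit c) (a b : R) :
    {g | g * σ g = c ∧ a * g = b}.ncard ^ 2 * Nat.card (Ideal.span {a, σ a}) ≤
      4 * {g | g * σ g = c}.ncard ^ 2 := by
  rcases Set.eq_empty_or_nonempty {g | g * σ g = c ∧ a * g = b} with hempty | ⟨g₀, hg₀, -⟩
  · simp [hempty]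
  grw [ncard_mul_eq_le hc a b,
    sq_card_normOneUnits_inf_fixingSubgroup_mul_card_le hR hσ hθ (span_pair_le_comap hσ a),
    card_normOneUnits_le_ncard hc hg₀]

end Involution

section Entropy

theorem rpow_qEntropy {q : ℕ} (hq : 2 ≤ q) {δ : ℝ} (h0 : 0 < δ) (h1 : δ < 1) :
    (δ / ((1 - δ) * (q - 1))) ^ (-δ) * (1 + (q - 1) * (δ / ((1 - δ) * (q - 1)))) =
      (q : ℝ) ^ qEntropy q δ := by
  have hq₂ : (2 : ℝ) ≤ q := by exact_mod_cast hq
  have hq₁ : (0 : ℝ) < q - 1 := by linarith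
  have hδ : 0 < 1 - δ := by linarith
  have hlog : Real.log q ≠ 0 := (Real.log_pos (by linarith)).ne'
  have hsum : 1 + (q - 1) * (δ / ((1 - δ) * (q - 1))) = (1 - δ)⁻¹ := by field_simp; ring
  rw [hsum]
  refine Real.log_injOn_pos (Set.mem_Ioi.2 (by positivity)) (Set.mem_Ioi.2 (by positivity)) ?_
  rw [Real.log_mul (by positivity) (by positivity), Real.log_rpow (by positivity),
    Real.log_rpow (by positivity), Real.log_inv, Real.log_div h0.ne' (by positivity),
    Real.log_mul hδ.ne' hq₁.ne', qEntropy]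
  simp only [Real.logb]
  field_simp
  ring

theorem div_one_sub_mul_le_one {q : ℝ} (hq : 1 < q) {δ : ℝ} (hδ : δ ≤ 1 - q⁻¹) :
    δ / ((1 - δ) * (q - 1)) ≤ 1 := by
  have hinv : 0 < q⁻¹ := by positivity
  rw [div_le_one (mul_pos (by linarith) (by linarith))]
  have hmul := mul_le_mul_of_nonneg_right hδ (by linarith : 0 ≤ q)
  rw [sub_mul, inv_mul_cancel₀ (by linarith)] at hmul
  linarith

end Entropy

section InformationSets

variable {F : Type*} [Field F] {ι : Type*}

/-- A set of coordinates is an information set of a code if its entries can be prescribed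
arbitrarily and determine the codeword. -/
def IsInformationSet (V : Submodule F (ι → F)) (I : Finset ι) : Prop :=
  ∀ w : ι → F, ∃! v, v ∈ V ∧ ∀ i ∈ I, v i = w i

theorem exists_isInformationSet [Finite ι] (V : Submodule F (ι → F)) :
    ∃ I : Finset ι, IsInformationSet V I := by
  classical
  obtain ⟨I, -, hI⟩ := Finite.exists_le_maximal
    (p := fun I : Finset ι => ∀ w : ι → F, ∃ v ∈ V, ∀ i ∈ I, v i = w i) (a := ∅)
    fun _ => ⟨0, V.zero_mem, by simp⟩
  have hker (v) (hv : v ∈ V) (hvI : ∀ i ∈ I, v i = 0) : v = 0 := by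
    by_contra hne
    obtain ⟨k, hk⟩ := Function.ne_iff.1 hne
    have hins : ∀ w : ι → F, ∃ u ∈ V, ∀ i ∈ insert k I, u i = w i := by
      intro w
      obtain ⟨u, hu, huw⟩ := hI.prop w
      refine ⟨u + ((w k - u k) / v k) • v, V.add_mem hu (V.smul_mem _ hv), ?_⟩
      rw [Finset.forall_mem_insert]
      refine ⟨?_, fun i hi => by simp [huw i hi, hvI i hi]⟩
      simp [div_mul_cancel₀ _ hk]
    exact hk (hvI k (hI.le_of_ge hins (Finset.subset_insert k I) (Finset.mem_insert_self k I)))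
  refine ⟨I, fun w => ?_⟩
  obtain ⟨v, hv, hvw⟩ := hI.prop w
  refine ⟨v, ⟨hv, hvw⟩, fun u hu => sub_eq_zero.1 (hker _ (V.sub_mem hu.1 hv) fun i hi => ?_)⟩
  rw [Pi.sub_apply, hu.2 i hi, hvw i hi, sub_self]

namespace IsInformationSet

variable {V : Submodule F (ι → F)} {I : Finset ι}

theorem bijective_restrict (hI : IsInformationSet V I) :
    Function.Bijective fun (v : V) (i : I) => (v : ι → F) i := by
  classical
  refine ⟨fun v v' hvv' => Subtype.ext ?_, fun y => ?_⟩
  · exact (hI v').unique ⟨v.2, fun i hi => congrFun hvv' ⟨i, hi⟩⟩ ⟨v'.2, fun _ _ => rfl⟩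
  · obtain ⟨v, ⟨hv, hvy⟩, -⟩ := hI fun i => if hi : i ∈ I then y ⟨i, hi⟩ else 0
    exact ⟨⟨v, hv⟩, funext fun i => by simp [hvy i i.2]⟩

theorem card_pow_card [Fintype F] (hI : IsInformationSet V I) :
    Fintype.card F ^ I.card = Nat.card V := by
  classical
  rw [Nat.card_congr (Equiv.ofBijective _ hI.bijective_restrict), Nat.card_eq_fintype_card,
    Fintype.card_fun, Fintype.card_coe]

theorem map_addRight [AddGroup ι] (hV : ∀ v ∈ V, ∀ j, (fun i => v (i + j)) ∈ V)
    (hI : IsInformationSet V I) (j : ι) :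
    IsInformationSet V (I.map (Equiv.addRight j).toEmbedding) := by
  intro w
  obtain ⟨v, ⟨hv, hvw⟩, huniq⟩ := hI fun i => w (i + j)
  refine ⟨fun i => v (i - j), ⟨?_, Finset.forall_mem_map.2 fun i hi => ?_⟩, fun u ⟨hu, huw⟩ => ?_⟩
  · simpa only [sub_eq_add_neg] using hV v hv (-j)
  · simp [hvw i hi]
  · rw [← huniq _ ⟨hV u hu j, Finset.forall_mem_map.1 huw⟩]
    simp

theorem disjSum {κ : Type*} {W : Submodule F (κ → F)} {K : Finset κ}
    (hI : IsInformationSet V I) (hK : IsInformationSet W K) :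
    IsInformationSet (V.comap (LinearMap.funLeft F F Sum.inl) ⊓
      W.comap (LinearMap.funLeft F F Sum.inr)) (I.disjSum K) := by
  intro w
  obtain ⟨v, ⟨hv, hvw⟩, hvuniq⟩ := hI (w ∘ Sum.inl)
  obtain ⟨u, ⟨hu, huw⟩, huuniq⟩ := hK (w ∘ Sum.inr)
  refine ⟨Sum.elim v u, ⟨⟨hv, hu⟩, ?_⟩, fun c ⟨⟨hcv, hcu⟩, hcw⟩ => ?_⟩
  · simpa using ⟨hvw, huw⟩
  · rw [← hvuniq _ ⟨hcv, fun i hi => hcw _ (Finset.inl_mem_disjSum.2 hi)⟩,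
      ← huuniq _ ⟨hcu, fun i hi => hcw _ (Finset.inr_mem_disjSum.2 hi)⟩]
    exact (Sum.elim_comp_inl_inr c).symm

end IsInformationSet

end InformationSets

section LightWords

variable {F : Type*} [Field F] [DecidableEq F] {ι : Type*}

theorem hammingNorm_restrict (I : Finset ι) (v : ι → F) :
    hammingNorm (fun i : I => v i) = (I.filter fun i => v i ≠ 0).card := by
  rw [hammingNorm, ← Finset.card_map (Function.Embedding.subtype _)]
  congr 1
  ext i
  simp [and_comm]

theorem sum_pow_hammingNorm [Fintype F] [Fintype ι] [DecidableEq ι] (z : ℝ) :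
    ∑ y : ι → F, z ^ hammingNorm y = (1 + (Fintype.card F - 1) * z) ^ Fintype.card ι := by
  have hprod (y : ι → F) : z ^ hammingNorm y = ∏ i, if y i = 0 then 1 else z := by
    rw [hammingNorm, Finset.prod_ite, Finset.prod_const_one, one_mul, Finset.prod_const]
  have hcoord : ∑ c : F, (if c = 0 then 1 else z) = 1 + (Fintype.card F - 1) * z := by
    rw [← Finset.add_sum_erase _ _ (Finset.mem_univ (0 : F)), if_pos rfl,
      Finset.sum_congr rfl fun c hc => if_neg (Finset.ne_of_mem_erase hc), Finset.sum_const,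
      Finset.card_erase_of_mem (Finset.mem_univ _), Finset.card_univ, nsmul_eq_mul,
      Nat.cast_pred Fintype.card_pos]
  simp_rw [hprod]
  rw [← hcoord, ← Finset.card_univ, ← Finset.prod_const, Finset.prod_univ_sum,
    Fintype.piFinset_univ]

theorem sum_card_filter_of_balanced {J : Type*} [Fintype J] [Fintype ι] [DecidableEq ι]
    {S : J → Finset ι} {t : ℕ} (hS : ∀ i, (Finset.univ.filter fun j => i ∈ S j).card = t)
    (p : ι → Prop) [DecidablePred p] :
    ∑ j, ((S j).filter p).card = t * (Finset.univ.filter p).card := by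
  have hswap := Finset.sum_card_bipartiteAbove_eq_sum_card_bipartiteBelow
    (s := Finset.univ) (t := Finset.univ.filter p) fun (j : J) i => i ∈ S j
  simp only [Finset.bipartiteAbove, Finset.bipartiteBelow, hS, Finset.sum_const,
    smul_eq_mul] at hswap
  rw [mul_comm, ← hswap]
  refine Finset.sum_congr rfl fun j _ => congrArg _ ?_
  ext i
  simp [and_comm]

open scoped Classical in
theorem IsInformationSet.sum_pow_card_filter_ne_zero [Fintype F] [Fintype ι]
    {V : Submodule F (ι → F)} {I : Finset ι} (hI : IsInformationSet V I) (z : ℝ) :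
    ∑ v : V, z ^ (I.filter fun i => (v : ι → F) i ≠ 0).card =
      (1 + (Fintype.card F - 1) * z) ^ I.card := by
  rw [← Fintype.card_coe I, ← sum_pow_hammingNorm (F := F) (ι := I) z]
  refine Fintype.sum_bijective _ hI.bijective_restrict _ _ fun v => ?_
  rw [hammingNorm_restrict]

theorem IsInformationSet.ncard_light_le [Fintype F] [Finite ι] {V : Submodule F (ι → F)}
    {I : Finset ι} (hI : IsInformationSet V I) {δ : ℝ} (h0 : 0 < δ)
    (h1 : δ ≤ 1 - (Fintype.card F : ℝ)⁻¹) :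
    ({v ∈ (V : Set (ι → F)) | ((I.filter fun i => v i ≠ 0).card : ℝ) ≤ δ * I.card}.ncard : ℝ) ≤
      (Nat.card V : ℝ) ^ qEntropy (Fintype.card F) δ := by
  classical
  have := Fintype.ofFinite ι
  set q := Fintype.card F
  have hq : 2 ≤ q := Fintype.one_lt_card
  have hq' : (1 : ℝ) < q := by exact_mod_cast hq
  have hδ : 0 < 1 - δ := by linarith [inv_pos.2 (zero_lt_one.trans hq')]
  set z : ℝ := δ / ((1 - δ) * (q - 1))
  have hz0 : 0 < z := div_pos h0 (mul_pos hδ (sub_pos.2 hq'))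
  have hz1 : z ≤ 1 := div_one_sub_mul_le_one hq' h1
  -- Chernoff bound: `z ^ (wt v - δ |I|) ≥ 1` for the light words `v`.
  calc ({v ∈ (V : Set (ι → F)) | ((I.filter fun i => v i ≠ 0).card : ℝ) ≤ δ * I.card}.ncard : ℝ)
      = ∑ v : V, if ((I.filter fun i => (v : ι → F) i ≠ 0).card : ℝ) ≤ δ * I.card
          then (1 : ℝ) else 0 := by
        rw [Finset.sum_boole, ← Fintype.card_subtype, ← Nat.card_eq_fintype_card,
          Nat.card_congr (Equiv.subtypeSubtypeEquivSubtypeInter (· ∈ V) fun v =>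
            ((I.filter fun i => v i ≠ 0).card : ℝ) ≤ δ * I.card)]
        rfl
    _ ≤ ∑ v : V, z ^ (-δ * I.card) * z ^ (I.filter fun i => (v : ι → F) i ≠ 0).card := by
        gcongr with v
        split_ifs with hv
        · rw [← Real.rpow_natCast, ← Real.rpow_add hz0]
          exact Real.one_le_rpow_of_pos_of_le_one_of_nonpos hz0 hz1 (by linarith)
        · positivity
    _ = (z ^ (-δ) * (1 + (q - 1) * z)) ^ I.card := by
        rw [← Finset.mul_sum, hI.sum_pow_card_filter_ne_zero, Real.rpow_mul_natCast hz0.le,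
          ← mul_pow]
    _ = (Nat.card V : ℝ) ^ qEntropy q δ := by
        rw [rpow_qEntropy hq h0 (by linarith), ← hI.card_pow_card, Nat.cast_pow,
          Real.rpow_pow_comm (by positivity)]

theorem exists_card_filter_ne_zero_le [Fintype ι] [DecidableEq ι] {J : Type*} [Fintype J]
    [Nonempty J] {S : J → Finset ι} {t : ℕ}
    (ht : ∀ i, (Finset.univ.filter fun j => i ∈ S j).card = t) {δ : ℝ} {v : ι → F}
    (hv : (hammingNorm v : ℝ) ≤ δ * Fintype.card ι) :
    ∃ j, (((S j).filter fun i => v i ≠ 0).card : ℝ) ≤ δ * (S j).card := by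
  by_contra! hheavy
  have hlt := Finset.sum_lt_sum_of_nonempty Finset.univ_nonempty fun j _ => hheavy j
  have htotal : ∑ j, (S j).card = t * Fintype.card ι := by
    simpa using sum_card_filter_of_balanced ht fun _ => True
  rw [← Finset.mul_sum, ← Nat.cast_sum, ← Nat.cast_sum, sum_card_filter_of_balanced ht,
    htotal, ← hammingNorm] at hlt
  push_cast at hlt
  nlinarith [mul_le_mul_of_nonneg_left hv (Nat.cast_nonneg (α := ℝ) t)]

theorem ncard_light_le_of_balanced [Fintype F] [Fintype ι] [DecidableEq ι]
    {V : Submodule F (ι → F)} {J : Type*} [Fintype J] [Nonempty J] {S : J → Finset ι}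
    (hS : ∀ j, IsInformationSet V (S j)) {t : ℕ}
    (ht : ∀ i, (Finset.univ.filter fun j => i ∈ S j).card = t) {δ : ℝ} (h0 : 0 < δ)
    (h1 : δ ≤ 1 - (Fintype.card F : ℝ)⁻¹) :
    ({v ∈ (V : Set (ι → F)) | (hammingNorm v : ℝ) ≤ δ * Fintype.card ι}.ncard : ℝ) ≤
      Fintype.card J * (Nat.card V : ℝ) ^ qEntropy (Fintype.card F) δ := by
  have hcover : {v ∈ (V : Set (ι → F)) | (hammingNorm v : ℝ) ≤ δ * Fintype.card ι} ⊆
      ⋃ j, {v ∈ (V : Set (ι → F)) |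
        (((S j).filter fun i => v i ≠ 0).card : ℝ) ≤ δ * (S j).card} := by
    rintro v ⟨hv, hlight⟩
    obtain ⟨j, hj⟩ := exists_card_filter_ne_zero_le ht hlight
    exact Set.mem_iUnion.2 ⟨j, hv, hj⟩
  calc ({v ∈ (V : Set (ι → F)) | (hammingNorm v : ℝ) ≤ δ * Fintype.card ι}.ncard : ℝ)
      ≤ ∑ j, ({v ∈ (V : Set (ι → F)) |
          (((S j).filter fun i => v i ≠ 0).card : ℝ) ≤ δ * (S j).card}.ncard : ℝ) := by
        exact_mod_cast (Set.ncard_le_ncard hcover (Set.toFinite _)).trans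
          (Set.ncard_iUnion_le_of_fintype _)
    _ ≤ ∑ _ : J, (Nat.card V : ℝ) ^ qEntropy (Fintype.card F) δ := by
        gcongr with j
        exact (hS j).ncard_light_le h0 h1
    _ = _ := by rw [Finset.sum_const, Finset.card_univ, nsmul_eq_mul]

end LightWords

section FiniteFields

theorem card_pow_orderOf_natCast_le {F K : Type*} [Field F] [Field K] [Algebra F K] [Finite K]
    {y : Kˣ} {n : ℕ} (hy : orderOf y = n) :
    Nat.card F ^ orderOf (Nat.card F : ZMod n) ≤ Nat.card K := by
  subst hy
  have : Finite F := Finite.of_injective _ (algebraMap F K).injective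
  have hK : Nat.card K = Nat.card F ^ Module.finrank F K := Module.natCard_eq_pow_finrank
  have hone : (Nat.card F : ZMod (orderOf y)) ^ Module.finrank F K = 1 := by
    have hdvd := orderOf_dvd_natCard y
    rw [Nat.card_units, ← ZMod.natCast_eq_zero_iff, Nat.cast_pred Nat.card_pos, sub_eq_zero,
      hK] at hdvd
    exact_mod_cast hdvd
  rw [hK]
  exact Nat.pow_le_pow_right Nat.card_pos
    (Nat.le_of_dvd Module.finrank_pos (orderOf_dvd_of_pow_eq_one hone))

theorem exists_pow_add_one_eq_neg_one {F : Type*} [Field F] [Fintype F] {Q : ℕ}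
    (hF : Fintype.card F = Q * Q) : ∃ c : F, c ^ (Q + 1) = -1 := by
  by_cases h2 : ringChar F = 2
  · have : CharP F 2 := ringChar.of_eq h2
    exact ⟨1, by rw [one_pow, CharTwo.neg_eq]⟩
  · obtain ⟨a, ha⟩ := FiniteField.exists_nonsquare h2
    have ha0 : a ≠ 0 := by rintro rfl; exact ha (IsSquare.zero)
    have hpow : a ^ (Fintype.card F / 2) = -1 :=
      (FiniteField.pow_dichotomy h2 ha0).resolve_left
        fun h => ha ((FiniteField.isSquare_iff h2 ha0).2 h)
    have hodd : Fintype.card F % 2 = 1 := FiniteField.odd_card_of_char_ne_two h2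
    obtain ⟨k, rfl⟩ : Odd Q := (Nat.odd_mul.1 (hF ▸ Nat.odd_iff.2 hodd)).1
    refine ⟨a ^ k, ?_⟩
    rw [← pow_mul, ← hpow, hF]
    congr 1
    have : (2 * k + 1) * (2 * k + 1) = 2 * (k * (2 * k + 1 + 1)) + 1 := by ring
    omega

theorem exists_pow_ne_self {F : Type*} [Field F] [Fintype F] {Q : ℕ} (hQ : 1 < Q)
    (hF : Q < Fintype.card F) : ∃ c : F, c ^ Q ≠ c := by
  by_contra! h
  have hzero : (X ^ Q - X : F[X]) = 0 :=
    eq_zero_of_natDegree_lt_card_of_eval_eq_zero _ Function.injective_id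
      (fun c => by simp [h c]) (by rwa [FiniteField.X_pow_card_sub_X_natDegree_eq F hQ])
  exact FiniteField.X_pow_card_sub_X_ne_zero F hQ hzero

end FiniteFields

section LinearCodes

variable {F : Type*} [Field F] {ι : Type*} [Fintype ι]

theorem lt_relMinDistance [DecidableEq F] {C : Submodule F (ι → F)} (hC : C ≠ ⊥) {δ : ℝ}
    (h : ∀ c ∈ C, c ≠ 0 → δ * Fintype.card ι < hammingNorm c) : δ < relMinDistance C := by
  obtain ⟨w, hw, hw0⟩ := Submodule.exists_mem_ne_zero_of_ne_bot hC
  obtain ⟨i, -⟩ := Function.ne_iff.1 hw0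
  have hcard : 0 < Fintype.card ι := Fintype.card_pos_iff.2 ⟨i⟩
  obtain ⟨c, hc, c', hc', hcc, hd⟩ := Nat.sInf_mem
    (s := {d | ∃ c ∈ C, ∃ c' ∈ C, c ≠ c' ∧ hammingDist c c' = d})
    ⟨_, w, hw, 0, C.zero_mem, hw0, rfl⟩
  rw [relMinDistance, minDistance, ← hd, lt_div_iff₀ (by exact_mod_cast hcard),
    hammingDist_eq_hammingNorm]
  refine h _ ?_ ?_
  · rw [neg_add_eq_sub]
    exact C.sub_mem hc' hc
  · rwa [neg_add_eq_sub, sub_ne_zero, ne_comm]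

theorem hammingNorm_eq_card [DecidableEq F] {c : ι → F} (hc : ∀ i, c i ≠ 0) :
    hammingNorm c = Fintype.card ι := by
  rw [hammingNorm, Finset.filter_true_of_mem fun i _ => hc i, Finset.card_univ]

end LinearCodes

section CyclicWords

variable {F : Type*} [Field F] {n : ℕ}

namespace CycAlg

theorem x_pow_mod (k : ℕ) : x F n ^ (k % n) = x F n ^ k :=
  (pow_eq_pow_mod k (x_pow n)).symm

theorem x_pow_val_add (i j : Fin n) :
    x F n ^ ((i + j : Fin n) : ℕ) = x F n ^ (i : ℕ) * x F n ^ (j : ℕ) := by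
  rw [Fin.val_add, x_pow_mod, pow_add]

theorem isReduced (hn : (n : F) ≠ 0) : IsReduced (CycAlg F n) := by
  have hsq : Squarefree (X ^ n - 1 : F[X]) := (X_pow_sub_one_separable_iff.2 hn).squarefree
  exact (Ideal.isRadical_iff_quotient_reduced _).1 (isRadical_iff_span_singleton.1 hsq.isRadical)

theorem exists_sub_algebraMap_mem_span (r : CycAlg F n) :
    ∃ c : F, r - algebraMap F (CycAlg F n) c ∈ Ideal.span {x F n - 1} := by
  obtain ⟨f, rfl⟩ := AdjoinRoot.mk_surjective r
  refine ⟨f.eval 1, Ideal.mem_span_singleton.2 ?_⟩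
  simpa only [map_sub, AdjoinRoot.mk_X, AdjoinRoot.mk_C, map_one, AdjoinRoot.algebraMap_eq]
    using
    map_dvd (AdjoinRoot.mk (X ^ n - 1 : F[X])) (X_sub_C_dvd_sub_C_eval (a := 1) (p := f))

theorem eq_of_x_sub_one_mem {m m' : Ideal (CycAlg F n)} (hm : m.IsMaximal) (hm' : m'.IsMaximal)
    (h : x F n - 1 ∈ m) (h' : x F n - 1 ∈ m') : m = m' := by
  refine hm.eq_of_le hm'.ne_top fun r hr => ?_
  obtain ⟨c, hc⟩ := exists_sub_algebraMap_mem_span r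
  have hcm : algebraMap F (CycAlg F n) c ∈ m := by
    simpa using m.sub_mem hr (m.span_singleton_le_iff_mem.2 h hc)
  have hc0 : c = 0 := by
    by_contra hc0
    exact hm.ne_top (Ideal.eq_top_of_isUnit_mem _ hcm ((IsUnit.mk0 c hc0).map _))
  rw [hc0, map_zero, sub_zero] at hc
  exact m'.span_singleton_le_iff_mem.2 h' hc

theorem card_le_card_quotient {m : Ideal (CycAlg F n)} [Finite (CycAlg F n ⧸ m)] (hm : m ≠ ⊤) :
    Nat.card F ≤ Nat.card (CycAlg F n ⧸ m) := by
  have := Ideal.Quotient.nontrivial_iff.2 hm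
  exact Nat.card_le_card_of_injective _ (algebraMap F (CycAlg F n ⧸ m)).injective

theorem pow_orderOf_le_card_quotient (hn : n.Prime) {m : Ideal (CycAlg F n)}
    [Finite (CycAlg F n ⧸ m)] (hm : m.IsMaximal) (h : x F n - 1 ∉ m) :
    Nat.card F ^ orderOf (Nat.card F : ZMod n) ≤ Nat.card (CycAlg F n ⧸ m) := by
  let := Ideal.Quotient.field m
  have := Fact.mk hn
  have hy : Ideal.Quotient.mk m (x F n) ^ n = 1 := by rw [← map_pow, x_pow, map_one]
  let y := Units.ofPowEqOne _ n hy hn.ne_zero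
  have hy1 : y ≠ 1 := by
    intro hy1
    refine h (Ideal.Quotient.eq.1 ?_)
    rw [map_one]
    exact congrArg Units.val hy1
  exact card_pow_orderOf_natCast_le (orderOf_eq_prime (Units.pow_ofPowEqOne hy hn.ne_zero) hy1)

end CycAlg

theorem cycStar_of (p h : ℕ) [Fact p.Prime] [CharP F p] (c : F) :
    cycStar p h n (AdjoinRoot.of _ c) = AdjoinRoot.of _ (c ^ p ^ h) := by
  rw [cycStar, AdjoinRoot.lift_of, RingHom.comp_apply, iterateFrobenius_def]

theorem mem_pairCode_one {g : CycAlg F n} {c : Fin n ⊕ Fin n → F} :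
    c ∈ pairCode 1 g ↔
      wordToCyc F n (c ∘ Sum.inr) = wordToCyc F n (c ∘ Sum.inl) * g := by
  have hpair : wordToCycPair F n c =
    (wordToCyc F n (c ∘ Sum.inl), wordToCyc F n (c ∘ Sum.inr)) := rfl
  rw [pairCode, Submodule.mem_comap, Submodule.restrictScalars_mem,
    Submodule.mem_span_singleton, hpair]
  simp [eq_comm]

variable [NeZero n]

variable (F n) in
/-- The monomial basis of `F[X] / (X^n - 1)`. -/
noncomputable def cycBasis : Module.Basis (Fin n) F (CycAlg F n) :=
  (AdjoinRoot.powerBasis' (g := (X ^ n - 1 : F[X]))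
    (by simpa using monic_X_pow_sub_C (1 : F) (NeZero.ne n))).basis.reindex
    (finCongr (by rw [AdjoinRoot.powerBasis'_dim, ← C_1, natDegree_X_pow_sub_C]))

theorem cycBasis_apply (i : Fin n) : cycBasis F n i = CycAlg.x F n ^ (i : ℕ) := by
  rw [cycBasis, Module.Basis.reindex_apply, PowerBasis.basis_eq_pow, AdjoinRoot.powerBasis'_gen,
    finCongr_symm_apply, Fin.val_cast]

theorem wordToCyc_eq_equivFun_symm : wordToCyc F n = (cycBasis F n).equivFun.symm := by
  ext a
  simp [wordToCyc, Fintype.linearCombination_apply, cycBasis_apply]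

theorem wordToCyc_bijective : Function.Bijective (wordToCyc F n) := by
  rw [wordToCyc_eq_equivFun_symm]
  exact (cycBasis F n).equivFun.symm.bijective

theorem wordToCyc_eq_zero_iff {a : Fin n → F} : wordToCyc F n a = 0 ↔ a = 0 :=
  map_eq_zero_iff _ wordToCyc_bijective.injective

theorem wordToCyc_translate (a : Fin n → F) (j : Fin n) :
    wordToCyc F n (fun i => a (i - j)) = CycAlg.x F n ^ (j : ℕ) * wordToCyc F n a := by
  simp only [wordToCyc, Fintype.linearCombination_apply, Finset.mul_sum]
  rw [← Equiv.sum_comp (Equiv.addRight j)]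
  refine Finset.sum_congr rfl fun i _ => ?_
  rw [Equiv.coe_addRight, add_sub_cancel_right, CycAlg.x_pow_val_add, mul_smul_comm, mul_comm]

theorem wordToCyc_finRotate (a : Fin n → F) :
    wordToCyc F n (a ∘ (finRotate n).symm) = CycAlg.x F n * wordToCyc F n a := by
  obtain ⟨m, rfl⟩ := Nat.exists_eq_succ_of_ne_zero (NeZero.ne n)
  have hrotate : a ∘ (finRotate (m + 1)).symm = fun i => a (i - 1) := funext fun i =>
    congrArg a (by rw [Equiv.symm_apply_eq, finRotate_apply, sub_add_cancel])
  rw [hrotate, wordToCyc_translate, Fin.val_one', CycAlg.x_pow_mod, pow_one]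

theorem ne_zero_of_x_sub_one_mul_eq_zero {u : Fin n → F} (hu : u ≠ 0)
    (h : (CycAlg.x F n - 1) * wordToCyc F n u = 0) (i : Fin n) : u i ≠ 0 := by
  intro hi
  have hfix (k : ℕ) : CycAlg.x F n ^ k * wordToCyc F n u = wordToCyc F n u := by
    obtain ⟨r, hr⟩ := sub_one_dvd_pow_sub_one (CycAlg.x F n) k
    linear_combination wordToCyc F n u * hr + r * h
  have hconst (j : Fin n) : u (i - j) = u i :=
    congrFun (wordToCyc_bijective.injective ((wordToCyc_translate u j).trans (hfix j))) i
  exact hu (funext fun k => by rw [← sub_sub_cancel i k, hconst, hi, Pi.zero_apply])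

theorem natCard_cycAlg : Nat.card (CycAlg F n) = Nat.card F ^ n := by
  rw [← Nat.card_congr (Equiv.ofBijective _ (wordToCyc_bijective (F := F) (n := n))),
    Nat.card_fun, Nat.card_fin]

end CyclicWords

section HermitianSelfDual

variable {F : Type*} [Field F] {n : ℕ} [NeZero n]

/-- The constant coefficient on `F[X] / (X^n - 1)`. Its values on the products `r * s` form a
nondegenerate pairing. -/
noncomputable def constCoeff : CycAlg F n →ₗ[F] F := (cycBasis F n).coord 0

theorem constCoeff_wordToCyc (a : Fin n → F) : constCoeff (wordToCyc F n a) = a 0 := by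
  rw [constCoeff, wordToCyc_eq_equivFun_symm, Module.Basis.coord_apply,
    ← Module.Basis.equivFun_apply, LinearEquiv.coe_coe, LinearEquiv.apply_symm_apply]

theorem constCoeff_x_pow (i : Fin n) :
    constCoeff (CycAlg.x F n ^ (i : ℕ)) = if i = 0 then 1 else 0 := by
  rw [constCoeff, ← cycBasis_apply, Module.Basis.coord_apply, Module.Basis.repr_self,
    Finsupp.single_apply]

theorem eq_zero_of_constCoeff_mul_eq_zero {r : CycAlg F n}
    (h : ∀ s, constCoeff (s * r) = 0) : r = 0 := by
  obtain ⟨a, rfl⟩ := wordToCyc_bijective.surjective r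
  refine wordToCyc_eq_zero_iff.2 (funext fun j => ?_)
  have hj := h (CycAlg.x F n ^ ((-j : Fin n) : ℕ))
  rwa [← wordToCyc_translate, constCoeff_wordToCyc, sub_neg_eq_add, zero_add] at hj

theorem x_pow_mul_x_pow_pred_mul (i j : Fin n) :
    CycAlg.x F n ^ (i : ℕ) * CycAlg.x F n ^ ((n - 1) * (j : ℕ)) =
      CycAlg.x F n ^ ((i - j : Fin n) : ℕ) := by
  have hj : (j : ℕ) + (n - 1) * j = n * j := by
    rw [← one_add_mul, Nat.add_sub_cancel' NeZero.one_le]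
  rw [← sub_add_cancel i j, CycAlg.x_pow_val_add, mul_assoc, ← pow_add, hj, pow_mul, CycAlg.x_pow,
    one_pow, mul_one, sub_add_cancel]

theorem constCoeff_mul_cycStar (p h : ℕ) [Fact p.Prime] [CharP F p] (c a : Fin n → F) :
    constCoeff (wordToCyc F n c * cycStar p h n (wordToCyc F n a)) = galoisInner p h c a := by
  rw [cycStar_wordToCyc, wordToCyc, Fintype.linearCombination_apply, Finset.sum_mul_sum]
  simp only [smul_mul_smul_comm, x_pow_mul_x_pow_pred_mul, map_sum, map_smul, constCoeff_x_pow,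
    sub_eq_zero, smul_eq_mul, mul_ite, mul_one, mul_zero, Finset.sum_ite_eq, Finset.mem_univ,
    if_true, galoisInner]

theorem galoisInner_eq_constCoeff (p h : ℕ) [Fact p.Prime] [CharP F p]
    (c a : Fin n ⊕ Fin n → F) :
    galoisInner p h c a = constCoeff
      (wordToCyc F n (c ∘ Sum.inl) * cycStar p h n (wordToCyc F n (a ∘ Sum.inl)) +
        wordToCyc F n (c ∘ Sum.inr) * cycStar p h n (wordToCyc F n (a ∘ Sum.inr))) := by
  rw [map_add, constCoeff_mul_cycStar, constCoeff_mul_cycStar]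
  simp only [galoisInner, Fintype.sum_sum_type, Function.comp_apply]

theorem cycStar_x_mul (p h : ℕ) [Fact p.Prime] [CharP F p] :
    cycStar p h n (CycAlg.x F n) * CycAlg.x F n = 1 := by
  rw [cycStar, AdjoinRoot.lift_root, ← pow_succ, Nat.sub_add_cancel (NeZero.pos n), CycAlg.x_pow]

theorem cycStar_involutive [Fintype F] (p h : ℕ) [Fact p.Prime] [CharP F p]
    (hF : Fintype.card F = p ^ h * p ^ h) : Function.Involutive (cycStar (F := F) p h n) := by
  refine RingHom.congr_fun (f := (cycStar p h n).comp (cycStar p h n)) (g := RingHom.id _)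
    (AdjoinRoot.ringHom_ext (RingHom.ext fun c => ?_) ?_)
  · simp only [RingHom.comp_apply, RingHom.id_apply, cycStar_of]
    rw [← pow_mul, ← hF, FiniteField.pow_card]
  · have hx := cycStar_x_mul (F := F) (n := n) p h
    have hσx := congrArg (cycStar p h n) hx
    rw [map_mul, map_one] at hσx
    simp only [RingHom.comp_apply, RingHom.id_apply]
    linear_combination
      CycAlg.x F n * hσx - cycStar p h n (cycStar p h n (CycAlg.x F n)) * hx

theorem isTwoQuasiCyclic_pairCode (g : CycAlg F n) : IsTwoQuasiCyclic (pairCode 1 g) := by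
  intro c hc
  rw [mem_pairCode_one] at hc ⊢
  have hinl : doubleShift c ∘ Sum.inl = (c ∘ Sum.inl) ∘ (finRotate n).symm := rfl
  have hinr : doubleShift c ∘ Sum.inr = (c ∘ Sum.inr) ∘ (finRotate n).symm := rfl
  rw [hinl, hinr, wordToCyc_finRotate, wordToCyc_finRotate, hc, mul_assoc]

theorem exists_mem_pairCode_one (g r : CycAlg F n) : ∃ c ∈ pairCode 1 g,
    wordToCyc F n (c ∘ Sum.inl) = r ∧ wordToCyc F n (c ∘ Sum.inr) = r * g := by
  obtain ⟨u, hu⟩ := wordToCyc_bijective.surjective r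
  obtain ⟨v, hv⟩ := wordToCyc_bijective.surjective (r * g)
  refine ⟨Sum.elim u v, ?_, ?_, ?_⟩ <;>
    simp only [mem_pairCode_one, Sum.elim_comp_inl, Sum.elim_comp_inr, hu, hv]

theorem isGaloisSelfDual_pairCode (p h : ℕ) [Fact p.Prime] [CharP F p] [Fintype F]
    (hF : Fintype.card F = p ^ h * p ^ h) {g : CycAlg F n} (hg : g * cycStar p h n g = -1) :
    IsGaloisSelfDual p h (pairCode 1 g) := by
  have hσ := cycStar_involutive (F := F) (n := n) p h hF
  ext a
  set r := wordToCyc F n (a ∘ Sum.inl) with hr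
  set s := wordToCyc F n (a ∘ Sum.inr) with hs
  simp only [SetLike.mem_coe, galoisDual, Set.mem_ofPred_eq]
  constructor
  · intro ha c hc
    rw [mem_pairCode_one] at ha hc
    rw [galoisInner_eq_constCoeff, hc, ha, map_mul, ← hr]
    convert map_zero (constCoeff (F := F) (n := n)) using 2
    linear_combination wordToCyc F n (c ∘ Sum.inl) * cycStar p h n r * hg
  · intro ha
    have horth : cycStar p h n r + g * cycStar p h n s = 0 := by
      refine eq_zero_of_constCoeff_mul_eq_zero fun t => ?_
      obtain ⟨c, hc, hcl, hcr⟩ := exists_mem_pairCode_one g t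
      have hca := ha c hc
      rw [galoisInner_eq_constCoeff, hcl, hcr, ← hr, ← hs] at hca
      rw [mul_add, ← mul_assoc, hca]
    have hσorth := congrArg (cycStar p h n) horth
    rw [map_add, map_mul, map_zero, hσ, hσ] at hσorth
    rw [mem_pairCode_one]
    linear_combination -g * hσorth + s * hg

theorem eq_zero_of_mem_pairCode_one {g : CycAlg F n} {c : Fin n ⊕ Fin n → F}
    (hc : c ∈ pairCode 1 g) (hinl : c ∘ Sum.inl = 0) : c = 0 := by
  have hinr : c ∘ Sum.inr = 0 := by
    rw [← wordToCyc_eq_zero_iff, mem_pairCode_one.1 hc, hinl, map_zero, zero_mul]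
  rw [← Sum.elim_comp_inl_inr c, hinl, hinr, Sum.elim_zero_zero]

theorem finrank_pairCode_one (g : CycAlg F n) : Module.finrank F (pairCode 1 g) = n := by
  let π : pairCode 1 g →ₗ[F] Fin n → F := LinearMap.funLeft F F Sum.inl ∘ₗ (pairCode 1 g).subtype
  have hinj : Function.Injective π := (injective_iff_map_eq_zero _).2 fun c hc =>
    Subtype.ext (eq_zero_of_mem_pairCode_one c.2 hc)
  have hsurj : Function.Surjective π := fun u => by
    obtain ⟨c, hc, hcu, -⟩ := exists_mem_pairCode_one g (wordToCyc F n u)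
    exact ⟨⟨c, hc⟩, wordToCyc_bijective.injective hcu⟩
  rw [(LinearEquiv.ofBijective π ⟨hinj, hsurj⟩).finrank_eq, Module.finrank_fin_fun]

theorem codeRate_pairCode_one (g : CycAlg F n) : codeRate (pairCode 1 g) = 1 / 2 := by
  have hn : (n : ℝ) ≠ 0 := NeZero.ne _
  rw [codeRate, finrank_pairCode_one, Fintype.card_sum, Fintype.card_fin, Nat.cast_add,
    ← two_mul, one_div, ← div_div, div_right_comm, div_self hn, one_div]

theorem pairCode_one_ne_bot (g : CycAlg F n) : pairCode 1 g ≠ ⊥ := by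
  rw [Ne, ← Submodule.finrank_eq_zero, finrank_pairCode_one]
  exact NeZero.ne n

theorem hammingNorm_eq_card_of_x_sub_one_mul_eq_zero [DecidableEq F] {g : CycAlg F n}
    (hg : IsUnit g) {c : Fin n ⊕ Fin n → F} (hc : c ∈ pairCode 1 g) (hc0 : c ≠ 0)
    (h : (CycAlg.x F n - 1) * wordToCyc F n (c ∘ Sum.inl) = 0) :
    hammingNorm c = Fintype.card (Fin n ⊕ Fin n) := by
  have hinl : c ∘ Sum.inl ≠ 0 := fun hinl => hc0 (eq_zero_of_mem_pairCode_one hc hinl)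
  rw [mem_pairCode_one] at hc
  have hinr : c ∘ Sum.inr ≠ 0 := by
    rwa [Ne, ← wordToCyc_eq_zero_iff, hc, hg.mul_left_eq_zero, wordToCyc_eq_zero_iff]
  refine hammingNorm_eq_card (Sum.rec (ne_zero_of_x_sub_one_mul_eq_zero hinl h)
    (ne_zero_of_x_sub_one_mul_eq_zero hinr ?_))
  change (CycAlg.x F n - 1) * wordToCyc F n (c ∘ Sum.inr) = 0
  rw [hc, ← mul_assoc, h, zero_mul]

end HermitianSelfDual

section SubsetSums

open scoped Classical in
theorem sum_pow_card_inter_le {α : Type*} [Fintype α] {P : Finset α} {𝓢 : Finset (Finset α)}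
    (h𝓢 : ∀ s ∈ 𝓢, (s ∩ P).Nonempty) {y : ℝ} (hy : 0 ≤ y) :
    ∑ s ∈ 𝓢, y ^ (s ∩ P).card ≤ 2 ^ Pᶜ.card * ((1 + y) ^ P.card - 1) := by
  have hsplit : Function.Injective fun s : Finset α => (s ∩ Pᶜ, s ∩ P) := by
    intro s t hst
    obtain ⟨hout, hin⟩ : s ∩ Pᶜ = t ∩ Pᶜ ∧ s ∩ P = t ∩ P := Prod.mk.inj hst
    rw [← Finset.inter_univ s, ← Finset.inter_univ t, ← Finset.union_compl P,
      Finset.inter_union_distrib_left, Finset.inter_union_distrib_left, hin, hout]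
  have hbinomial : ∑ t ∈ P.powerset.erase ∅, y ^ t.card = (1 + y) ^ P.card - 1 := by
    have hsum := Finset.sum_pow_mul_eq_add_pow y 1 P
    simp only [one_pow, mul_one] at hsum
    rw [add_comm 1 y, ← hsum, ← Finset.add_sum_erase _ _ (Finset.empty_mem_powerset P),
      Finset.card_empty, pow_zero, add_sub_cancel_left]
  calc ∑ s ∈ 𝓢, y ^ (s ∩ P).card
      = ∑ t ∈ 𝓢.image fun s => (s ∩ Pᶜ, s ∩ P), y ^ t.2.card :=
        (Finset.sum_image (f := fun t : Finset α × Finset α => y ^ t.2.card)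
          hsplit.injOn).symm
    _ ≤ ∑ t ∈ Pᶜ.powerset ×ˢ P.powerset.erase ∅, y ^ t.2.card := by
        refine Finset.sum_le_sum_of_subset_of_nonneg (Finset.image_subset_iff.2 fun s hs => ?_)
          fun _ _ _ => by positivity
        exact Finset.mem_product.2 ⟨Finset.mem_powerset.2 Finset.inter_subset_right,
          Finset.mem_erase.2 ⟨(h𝓢 s hs).ne_empty,
            Finset.mem_powerset.2 Finset.inter_subset_right⟩⟩
    _ = 2 ^ Pᶜ.card * ((1 + y) ^ P.card - 1) := by
        simp only [Finset.sum_product, Finset.sum_const, Finset.card_powerset, hbinomial,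
          nsmul_eq_mul, Nat.cast_pow, Nat.cast_ofNat]

open scoped Classical in
theorem sum_pow_card_filter_not_le_le {R : Type*} [CommRing R] [IsArtinianRing R] [IsReduced R]
    [Fintype (MaximalSpectrum R)] {P : Finset (MaximalSpectrum R)} {𝓙 : Finset (Ideal R)}
    (h𝓙 : ∀ J ∈ 𝓙, ∃ m ∈ P, ¬ J ≤ m.asIdeal) {y : ℝ} (hy : 0 ≤ y) :
    ∑ J ∈ 𝓙, y ^ {m ∈ P | ¬ J ≤ m.asIdeal}.card ≤ 2 ^ Pᶜ.card * ((1 + y) ^ P.card - 1) := by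
  let support (J : Ideal R) : Finset (MaximalSpectrum R) := {m | ¬ J ≤ m.asIdeal}
  have hsupport (J : Ideal R) (m : MaximalSpectrum R) : m ∈ support J ↔ ¬ J ≤ m.asIdeal := by
    simp only [support, Finset.mem_filter, Finset.mem_univ, true_and]
  have hinter (J : Ideal R) : {m ∈ P | ¬ J ≤ m.asIdeal} = support J ∩ P := by
    ext m
    rw [Finset.mem_filter, Finset.mem_inter, hsupport, and_comm]
  have hinj : Function.Injective support := fun I J hIJ => by
    have hle (m : MaximalSpectrum R) : I ≤ m.asIdeal ↔ J ≤ m.asIdeal := by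
      rw [← not_iff_not, ← hsupport, ← hsupport, hIJ]
    exact le_antisymm (ideal_le_of_forall_maximal fun m => (hle m).2)
      (ideal_le_of_forall_maximal fun m => (hle m).1)
  simp only [hinter]
  rw [← Finset.sum_image (f := fun s => y ^ (s ∩ P).card) hinj.injOn]
  refine sum_pow_card_inter_le (Finset.forall_mem_image.2 fun J hJ => ?_) hy
  obtain ⟨m, hmP, hm⟩ := h𝓙 J hJ
  exact ⟨m, Finset.mem_inter.2 ⟨(hsupport J m).2 hm, hmP⟩⟩

theorem one_add_pow_sub_one_le {y : ℝ} {n : ℕ} (hy : 0 ≤ y) (hny : n * y ≤ 1) :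
    (1 + y) ^ n - 1 ≤ 2 * (n * y) := by
  have hexp : (1 + y) ^ n ≤ Real.exp (n * y) := by
    rw [Real.exp_nat_mul]
    exact pow_le_pow_left₀ (by linarith) (by linarith [Real.add_one_le_exp y]) n
  have h0 : 0 ≤ n * y := by positivity
  have habs := Real.abs_exp_sub_one_le (x := n * y) (by rwa [abs_of_nonneg h0])
  rw [abs_of_nonneg h0] at habs
  linarith [le_abs_self (Real.exp (n * y) - 1)]

end SubsetSums

section IdealCodes

variable {F : Type*} [Field F] {n : ℕ}

/-- The cyclic code of the words that correspond to the elements of an ideal of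
`F[X] / (X^n - 1)`. -/
noncomputable def idealCode (J : Ideal (CycAlg F n)) : Submodule F (Fin n → F) :=
  (J.restrictScalars F).comap (wordToCyc F n)

/-- The code `J × J` in `F^n × F^n`, for an ideal `J` of `F[X] / (X^n - 1)`. -/
noncomputable def idealPairCode (J : Ideal (CycAlg F n)) : Submodule F (Fin n ⊕ Fin n → F) :=
  (idealCode J).comap (LinearMap.funLeft F F Sum.inl) ⊓
    (idealCode J).comap (LinearMap.funLeft F F Sum.inr)

theorem mem_idealPairCode {J : Ideal (CycAlg F n)} {c : Fin n ⊕ Fin n → F} :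
    c ∈ idealPairCode J ↔
      wordToCyc F n (c ∘ Sum.inl) ∈ J ∧ wordToCyc F n (c ∘ Sum.inr) ∈ J :=
  Iff.rfl

variable [NeZero n]

theorem translate_mem_idealCode (J : Ideal (CycAlg F n)) :
    ∀ v ∈ idealCode J, ∀ j : Fin n, (fun i => v (i + j)) ∈ idealCode J := by
  intro v hv j
  have htranslate := wordToCyc_translate v (-j)
  simp only [sub_neg_eq_add] at htranslate
  change wordToCyc F n _ ∈ J
  rw [htranslate]
  exact J.mul_mem_left _ hv

theorem natCard_idealCode (J : Ideal (CycAlg F n)) : Nat.card (idealCode J) = Nat.card J :=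
  Nat.card_preimage_of_injective (s := (J : Set (CycAlg F n))) wordToCyc_bijective.injective
    fun _ _ => wordToCyc_bijective.surjective _

theorem card_filter_mem_map_addRight {G : Type*} [AddCommGroup G] [Fintype G] [DecidableEq G]
    (I : Finset G) (i : G) :
    (Finset.univ.filter fun j => i ∈ I.map (Equiv.addRight j).toEmbedding).card = I.card := by
  rw [← Finset.card_map (Equiv.subLeft i).toEmbedding]
  congr 1
  ext j
  simp

theorem ncard_light_idealPairCode_le [Fintype F] [DecidableEq F] (J : Ideal (CycAlg F n)) {δ : ℝ}
    (h0 : 0 < δ) (h1 : δ ≤ 1 - (Fintype.card F : ℝ)⁻¹) :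
    ({c ∈ (idealPairCode J : Set (Fin n ⊕ Fin n → F)) |
        (hammingNorm c : ℝ) ≤ δ * Fintype.card (Fin n ⊕ Fin n)}.ncard : ℝ) ≤
      n * ((Nat.card J : ℝ) ^ 2) ^ qEntropy (Fintype.card F) δ := by
  obtain ⟨I, hI⟩ := exists_isInformationSet (idealCode J)
  let T (j : Fin n) : Finset (Fin n) := I.map (Equiv.addRight j).toEmbedding
  have hT (j : Fin n) : IsInformationSet (idealCode J) (T j) :=
    hI.map_addRight (translate_mem_idealCode J) j
  have hS (j : Fin n) : IsInformationSet (idealPairCode J) ((T j).disjSum (T j)) :=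
    (hT j).disjSum (hT j)
  have hbalanced (i : Fin n ⊕ Fin n) :
      (Finset.univ.filter fun j => i ∈ (T j).disjSum (T j)).card = I.card := by
    rcases i with i | i
    · simpa only [Finset.inl_mem_disjSum] using card_filter_mem_map_addRight I i
    · simpa only [Finset.inr_mem_disjSum] using card_filter_mem_map_addRight I i
  have hcard : Nat.card (idealPairCode J) = Nat.card J ^ 2 := by
    rw [idealPairCode, ← (hI.disjSum hI).card_pow_card, Finset.card_disjSum, pow_add,
      hI.card_pow_card, natCard_idealCode, sq]
  simpa only [hcard, Nat.cast_pow, Fintype.card_fin] using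
    ncard_light_le_of_balanced hS hbalanced h0 h1

end IdealCodes

section MaximalIdeals

variable {F : Type*} [Field F] {n : ℕ} [Fintype (MaximalSpectrum (CycAlg F n))]

open scoped Classical in
variable (F n) in
/-- The maximal ideals of `F[X] / (X^n - 1)` other than the one generated by `X - 1`. -/
noncomputable def nontrivialMaximals : Finset (MaximalSpectrum (CycAlg F n)) :=
  {m | CycAlg.x F n - 1 ∉ m.asIdeal}

theorem mem_nontrivialMaximals {m : MaximalSpectrum (CycAlg F n)} :
    m ∈ nontrivialMaximals F n ↔ CycAlg.x F n - 1 ∉ m.asIdeal := by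
  simp only [nontrivialMaximals, Finset.mem_filter, Finset.mem_univ, true_and]

theorem card_compl_nontrivialMaximals_le_one [DecidableEq (MaximalSpectrum (CycAlg F n))] :
    (nontrivialMaximals F n)ᶜ.card ≤ 1 := by
  refine Finset.card_le_one.2 fun m hm m' hm' => ?_
  rw [Finset.mem_compl, mem_nontrivialMaximals, not_not] at hm hm'
  exact MaximalSpectrum.ext (CycAlg.eq_of_x_sub_one_mem m.isMaximal m'.isMaximal hm hm')

variable [NeZero n] [Finite F]

instance : Finite (CycAlg F n) :=
  Finite.of_surjective _ (wordToCyc_bijective (F := F) (n := n)).surjective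

theorem card_nontrivialMaximals_le : (nontrivialMaximals F n).card ≤ n := by
  have hle := pow_card_le_card_of_not_le (J := ⊤) (S := nontrivialMaximals F n)
    (fun m _ =>
      have := Quotient.finite (Submodule.quotientRel m.asIdeal)
      CycAlg.card_le_card_quotient m.isMaximal.ne_top)
    fun m _ hm => m.isMaximal.ne_top (top_le_iff.1 hm)
  rw [Nat.card_congr Submodule.topEquiv.toEquiv, natCard_cycAlg] at hle
  exact (Nat.pow_le_pow_iff_right Finite.one_lt_card).1 hle

theorem sum_inv_card_quotient_le {B : ℕ} (hF : 4 ≤ Nat.card F) (hBn : 4 * n ≤ B)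
    (hB : ∀ m ∈ nontrivialMaximals F n, B ≤ Nat.card (CycAlg F n ⧸ m.asIdeal)) :
    ∑ m : MaximalSpectrum (CycAlg F n), (Nat.card (CycAlg F n ⧸ m.asIdeal) : ℝ)⁻¹ ≤ 1 / 2 := by
  classical
  have hBpos : 0 < B := by have := NeZero.pos n; lia
  have htrivial : ∑ m ∈ (nontrivialMaximals F n)ᶜ, (Nat.card (CycAlg F n ⧸ m.asIdeal) : ℝ)⁻¹ ≤
      (nontrivialMaximals F n)ᶜ.card * (4 : ℝ)⁻¹ := by
    rw [← nsmul_eq_mul]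
    refine Finset.sum_le_card_nsmul _ _ _ fun m _ => inv_anti₀ (by norm_num) ?_
    have := Quotient.finite (Submodule.quotientRel m.asIdeal)
    exact_mod_cast hF.trans (CycAlg.card_le_card_quotient m.isMaximal.ne_top)
  have hnontrivial : ∑ m ∈ nontrivialMaximals F n, (Nat.card (CycAlg F n ⧸ m.asIdeal) : ℝ)⁻¹ ≤
      (nontrivialMaximals F n).card * (B : ℝ)⁻¹ := by
    rw [← nsmul_eq_mul]
    exact Finset.sum_le_card_nsmul _ _ _ fun m hm =>
      inv_anti₀ (by exact_mod_cast hBpos) (by exact_mod_cast hB m hm)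
  have hquarter : n * (B : ℝ)⁻¹ ≤ 1 / 4 := by
    rw [← div_eq_mul_inv, div_le_div_iff₀ (by exact_mod_cast hBpos) (by norm_num)]
    exact_mod_cast (by lia : n * 4 ≤ 1 * B)
  grw [← Finset.sum_compl_add_sum (nontrivialMaximals F n), htrivial, hnontrivial,
    card_compl_nontrivialMaximals_le_one, card_nontrivialMaximals_le, hquarter]
  norm_num

open scoped Classical in
theorem sum_pow_card_nontrivialMaximals_le [IsReduced (CycAlg F n)]
    {𝓙 : Finset (Ideal (CycAlg F n))}
    (h𝓙 : ∀ J ∈ 𝓙, ∃ m ∈ nontrivialMaximals F n, ¬ J ≤ m.asIdeal) {y : ℝ} (hy : 0 ≤ y)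
    (hny : n * y ≤ 1) :
    ∑ J ∈ 𝓙, y ^ {m ∈ nontrivialMaximals F n | ¬ J ≤ m.asIdeal}.card ≤ 4 * (n * y) := by
  have hpow : (1 : ℝ) ≤ (1 + y) ^ (nontrivialMaximals F n).card := one_le_pow₀ (by linarith)
  have hmono : (1 + y) ^ (nontrivialMaximals F n).card ≤ (1 + y) ^ n :=
    pow_le_pow_right₀ (by linarith) card_nontrivialMaximals_le
  have htwo : (2 : ℝ) ^ (nontrivialMaximals F n)ᶜ.card ≤ 2 :=
    (pow_le_pow_right₀ one_le_two card_compl_nontrivialMaximals_le_one).trans_eq (pow_one 2)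
  nlinarith [sum_pow_card_filter_not_le_le h𝓙 hy, one_add_pow_sub_one_le hy hny]

theorem exists_not_le_of_light [DecidableEq F] [IsReduced (CycAlg F n)] {g : CycAlg F n}
    (hg : IsUnit g) {c : Fin n ⊕ Fin n → F} (hc : c ∈ pairCode 1 g) (hc0 : c ≠ 0) {δ : ℝ}
    (hδ : δ < 1) (hlight : (hammingNorm c : ℝ) ≤ δ * Fintype.card (Fin n ⊕ Fin n))
    {J : Ideal (CycAlg F n)} (hJ : wordToCyc F n (c ∘ Sum.inl) ∈ J) :
    ∃ m ∈ nontrivialMaximals F n, ¬ J ≤ m.asIdeal := by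
  by_contra! hall
  have hfixed : (CycAlg.x F n - 1) * wordToCyc F n (c ∘ Sum.inl) = 0 := by
    refine Ideal.span_singleton_eq_bot.1 (le_bot_iff.1 (ideal_le_of_forall_maximal fun m _ => ?_))
    rw [Ideal.span_singleton_le_iff_mem]
    by_cases hm : m ∈ nontrivialMaximals F n
    · exact m.asIdeal.mul_mem_left _ (hall m hm hJ)
    · rw [mem_nontrivialMaximals, not_not] at hm
      exact m.asIdeal.mul_mem_right _ hm
  rw [hammingNorm_eq_card_of_x_sub_one_mul_eq_zero hg hc hc0 hfixed] at hlight
  have hpos : (0 : ℝ) < Fintype.card (Fin n ⊕ Fin n) := by exact_mod_cast Fintype.card_pos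
  nlinarith

end MaximalIdeals

section UnionBound

theorem ncard_biUnion_le_mul {α ι : Type*} {t : Set ι} (ht : t.Finite) {s : ι → Set α} {M : ℝ}
    (hs : ∀ i ∈ t, ((s i).ncard : ℝ) ≤ M) : ((⋃ i ∈ t, s i).ncard : ℝ) ≤ t.ncard * M := by
  lift t to Finset ι using ht
  rw [Set.ncard_coe_finset, ← nsmul_eq_mul]
  refine le_trans ?_ (Finset.sum_le_card_nsmul t _ M hs)
  exact_mod_cast t.set_ncard_biUnion_le s

theorem ncard_mul_eq_le_rpow {R : Type*} [CommRing R] [Finite R] [IsReduced R]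
    [Fintype (MaximalSpectrum R)]
    (hR : ∑ m : MaximalSpectrum R, (Nat.card (R ⧸ m.asIdeal) : ℝ)⁻¹ ≤ 1 / 2)
    {σ : R →+* R} (hσ : Function.Involutive σ) {θ : R} (hθ : IsUnit (σ θ - θ)) {c : R}
    (hc : IsUnit c) (a b : R) :
    ({g | g * σ g = c ∧ a * g = b}.ncard : ℝ) ≤
      2 * {g | g * σ g = c}.ncard * (Nat.card (Ideal.span {a, σ a}) : ℝ) ^ (-(1 / 2) : ℝ) := by
  have hpos : (0 : ℝ) < Nat.card (Ideal.span {a, σ a}) := by exact_mod_cast Nat.card_pos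
  rw [Real.rpow_neg hpos.le, ← Real.sqrt_eq_rpow, ← div_eq_mul_inv,
    le_div_iff₀ (Real.sqrt_pos.2 hpos)]
  refine le_of_sq_le_sq ?_ (by positivity)
  rw [mul_pow, Real.sq_sqrt hpos.le, mul_pow]
  norm_num
  exact_mod_cast sq_ncard_mul_eq_mul_card_le hR hσ hθ hc a b

variable {F : Type*} [Field F] [DecidableEq F] {n : ℕ}

/-- The solutions `g` of `g * σ g = -1` that have to be avoided because of the ideal `J`: those
for which `C_{1,g}` has a word `(a, a * g)` of relative weight at most `δ` such that `a` and
`σ a` generate `J`. -/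
def badMultipliers (σ : CycAlg F n →+* CycAlg F n) (δ : ℝ) (J : Ideal (CycAlg F n)) :
    Set (CycAlg F n) :=
  {g | g * σ g = -1 ∧ ∃ c ∈ pairCode 1 g,
    (hammingNorm c : ℝ) ≤ δ * Fintype.card (Fin n ⊕ Fin n) ∧
    Ideal.span {wordToCyc F n (c ∘ Sum.inl), σ (wordToCyc F n (c ∘ Sum.inl))} = J}

variable {σ : CycAlg F n →+* CycAlg F n} {δ : ℝ}

theorem badMultipliers_subset (J : Ideal (CycAlg F n)) :
    badMultipliers σ δ J ⊆ ⋃ c ∈ {c ∈ (idealPairCode J : Set (Fin n ⊕ Fin n → F)) |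
        (hammingNorm c : ℝ) ≤ δ * Fintype.card (Fin n ⊕ Fin n)},
      {g | g * σ g = -1 ∧ wordToCyc F n (c ∘ Sum.inl) * g = wordToCyc F n (c ∘ Sum.inr) ∧
        Ideal.span {wordToCyc F n (c ∘ Sum.inl), σ (wordToCyc F n (c ∘ Sum.inl))} = J} := by
  rintro g ⟨hg, c, hc, hcδ, rfl⟩
  rw [mem_pairCode_one] at hc
  have hinl : wordToCyc F n (c ∘ Sum.inl) ∈
      Ideal.span {wordToCyc F n (c ∘ Sum.inl), σ (wordToCyc F n (c ∘ Sum.inl))} :=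
    Ideal.subset_span (Set.mem_insert _ _)
  exact Set.mem_biUnion (x := c)
    ⟨mem_idealPairCode.2 ⟨hinl, hc ▸ Ideal.mul_mem_right _ _ hinl⟩, hcδ⟩ ⟨hg, hc.symm, rfl⟩

variable [NeZero n] [Fintype F] [Fintype (MaximalSpectrum (CycAlg F n))]

theorem ncard_badMultipliers_le [IsReduced (CycAlg F n)]
    (hR : ∑ m : MaximalSpectrum (CycAlg F n), (Nat.card (CycAlg F n ⧸ m.asIdeal) : ℝ)⁻¹ ≤ 1 / 2)
    (hσ : Function.Involutive σ) {θ : CycAlg F n} (hθ : IsUnit (σ θ - θ)) (h0 : 0 < δ)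
    (h1 : δ ≤ 1 - (Fintype.card F : ℝ)⁻¹) (J : Ideal (CycAlg F n)) :
    ((badMultipliers σ δ J).ncard : ℝ) ≤ 2 * n * {g : CycAlg F n | g * σ g = -1}.ncard *
      (Nat.card J : ℝ) ^ (-(1 / 2 - 2 * qEntropy (Fintype.card F) δ)) := by
  set D : Set (CycAlg F n) := {g | g * σ g = -1}
  set η := qEntropy (Fintype.card F) δ
  have hJ : (0 : ℝ) < Nat.card J := by exact_mod_cast Nat.card_pos
  set light := {c ∈ (idealPairCode J : Set (Fin n ⊕ Fin n → F)) |
    (hammingNorm c : ℝ) ≤ δ * Fintype.card (Fin n ⊕ Fin n)}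
  have hlight : (light.ncard : ℝ) ≤ n * ((Nat.card J : ℝ) ^ 2) ^ η :=
    ncard_light_idealPairCode_le J h0 h1
  have hsolutions (c : Fin n ⊕ Fin n → F) : ({g | g * σ g = -1 ∧
      wordToCyc F n (c ∘ Sum.inl) * g = wordToCyc F n (c ∘ Sum.inr) ∧
      Ideal.span {wordToCyc F n (c ∘ Sum.inl), σ (wordToCyc F n (c ∘ Sum.inl))} = J}.ncard : ℝ) ≤
      2 * D.ncard * (Nat.card J : ℝ) ^ (-(1 / 2) : ℝ) := by
    by_cases hspan :
        Ideal.span {wordToCyc F n (c ∘ Sum.inl), σ (wordToCyc F n (c ∘ Sum.inl))} = J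
    · simpa only [hspan, and_true] using ncard_mul_eq_le_rpow hR hσ hθ isUnit_one.neg
        (wordToCyc F n (c ∘ Sum.inl)) (wordToCyc F n (c ∘ Sum.inr))
    · simp only [hspan, and_false, Set.ofPred_false, Set.ncard_empty, Nat.cast_zero]
      positivity
  calc ((badMultipliers σ δ J).ncard : ℝ)
      ≤ light.ncard * (2 * D.ncard * (Nat.card J : ℝ) ^ (-(1 / 2) : ℝ)) := by
        grw [← ncard_biUnion_le_mul light.toFinite fun c _ => hsolutions c]
        exact_mod_cast Set.ncard_le_ncard (badMultipliers_subset J) (Set.toFinite _)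
    _ ≤ (n * ((Nat.card J : ℝ) ^ 2) ^ η) *
          (2 * D.ncard * (Nat.card J : ℝ) ^ (-(1 / 2) : ℝ)) := by grw [hlight]
    _ = 2 * n * D.ncard * (Nat.card J : ℝ) ^ (-(1 / 2 - 2 * η)) := by
        rw [← Real.rpow_natCast, ← Real.rpow_mul hJ.le,
          show -(1 / 2 - 2 * η) = (2 : ℕ) * η + -(1 / 2) by push_cast; ring, Real.rpow_add hJ]
        ring

open scoped Classical in
theorem ncard_badMultipliers_le_pow [IsReduced (CycAlg F n)]
    (hR : ∑ m : MaximalSpectrum (CycAlg F n), (Nat.card (CycAlg F n ⧸ m.asIdeal) : ℝ)⁻¹ ≤ 1 / 2)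
    (hσ : Function.Involutive σ) {θ : CycAlg F n} (hθ : IsUnit (σ θ - θ)) (h0 : 0 < δ)
    (h1 : δ ≤ 1 - (Fintype.card F : ℝ)⁻¹) (hent : qEntropy (Fintype.card F) δ ≤ 1 / 4) {B : ℕ}
    (hB0 : 0 < B) (hB : ∀ m ∈ nontrivialMaximals F n, B ≤ Nat.card (CycAlg F n ⧸ m.asIdeal))
    (J : Ideal (CycAlg F n)) :
    ((badMultipliers σ δ J).ncard : ℝ) ≤ 2 * n * {g : CycAlg F n | g * σ g = -1}.ncard *
      ((B : ℝ) ^ (-(1 / 2 - 2 * qEntropy (Fintype.card F) δ))) ^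
        {m ∈ nontrivialMaximals F n | ¬ J ≤ m.asIdeal}.card := by
  set k := {m ∈ nontrivialMaximals F n | ¬ J ≤ m.asIdeal}.card
  have hB' : (0 : ℝ) < B := by exact_mod_cast hB0
  have hcard : ((B : ℝ) ^ k) ≤ Nat.card J := by
    exact_mod_cast pow_card_le_card_of_not_le (fun m hm => hB m (Finset.mem_filter.1 hm).1)
      fun m hm => (Finset.mem_filter.1 hm).2
  refine (ncard_badMultipliers_le hR hσ hθ h0 h1 J).trans
    (mul_le_mul_of_nonneg_left ?_ (by positivity))
  rw [Real.rpow_pow_comm hB'.le]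
  exact Real.rpow_le_rpow_of_nonpos (by positivity) hcard (by linarith)

theorem exists_mul_map_eq_neg_one_forall_lt_hammingNorm [IsReduced (CycAlg F n)]
    (hR : ∑ m : MaximalSpectrum (CycAlg F n), (Nat.card (CycAlg F n ⧸ m.asIdeal) : ℝ)⁻¹ ≤ 1 / 2)
    (hσ : Function.Involutive σ) {θ : CycAlg F n} (hθ : IsUnit (σ θ - θ))
    (hne : {g : CycAlg F n | g * σ g = -1}.Nonempty) (h0 : 0 < δ)
    (h1 : δ ≤ 1 - (Fintype.card F : ℝ)⁻¹) (hent : qEntropy (Fintype.card F) δ ≤ 1 / 4) {B : ℕ}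
    (hB0 : 0 < B) (hB : ∀ m ∈ nontrivialMaximals F n, B ≤ Nat.card (CycAlg F n ⧸ m.asIdeal))
    (hBn : 8 * (n : ℝ) ^ 2 * (B : ℝ) ^ (-(1 / 2 - 2 * qEntropy (Fintype.card F) δ)) < 1) :
    ∃ g : CycAlg F n, g * σ g = -1 ∧ ∀ c ∈ pairCode 1 g, c ≠ 0 →
      δ * Fintype.card (Fin n ⊕ Fin n) < hammingNorm c := by
  classical
  by_contra! hbad
  set D := {g : CycAlg F n | g * σ g = -1}
  set y : ℝ := (B : ℝ) ^ (-(1 / 2 - 2 * qEntropy (Fintype.card F) δ))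
  have hy : 0 ≤ y := by positivity
  have := Fintype.ofFinite (Ideal (CycAlg F n))
  let 𝓙 : Finset (Ideal (CycAlg F n)) := {J | ∃ m ∈ nontrivialMaximals F n, ¬ J ≤ m.asIdeal}
  have hδ : δ < 1 := by linarith [inv_pos.2 (Nat.cast_pos (α := ℝ).2 (Fintype.card_pos (α := F)))]
  have hcover : D ⊆ ⋃ J ∈ 𝓙, badMultipliers σ δ J := fun g hg => by
    obtain ⟨c, hc, hc0, hlight⟩ := hbad g hg
    refine Set.mem_biUnion (Finset.mem_filter.2 ⟨Finset.mem_univ _, ?_⟩) ⟨hg, c, hc, hlight, rfl⟩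
    exact exists_not_le_of_light (isUnit_of_mul_map_eq isUnit_one.neg hg) hc hc0 hδ hlight
      (Ideal.subset_span (Set.mem_insert _ _))
  have hsum : ∑ J ∈ 𝓙, y ^ {m ∈ nontrivialMaximals F n | ¬ J ≤ m.asIdeal}.card ≤ 4 * (n * y) := by
    refine sum_pow_card_nontrivialMaximals_le (fun J hJ => (Finset.mem_filter.1 hJ).2) hy ?_
    have hn : (1 : ℝ) ≤ n := by exact_mod_cast NeZero.one_le
    nlinarith [mul_nonneg (sub_nonneg.2 hn) (mul_nonneg (Nat.cast_nonneg (α := ℝ) n) hy)]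
  have hD : (0 : ℝ) < D.ncard := by exact_mod_cast (Set.ncard_pos D.toFinite).2 hne
  have hcontra : (D.ncard : ℝ) ≤ D.ncard * (8 * (n : ℝ) ^ 2 * y) :=
    calc (D.ncard : ℝ) ≤ ∑ J ∈ 𝓙, ((badMultipliers σ δ J).ncard : ℝ) := by
          exact_mod_cast (Set.ncard_le_ncard hcover (Set.toFinite _)).trans
            (𝓙.set_ncard_biUnion_le _)
      _ ≤ ∑ J ∈ 𝓙, 2 * n * D.ncard *
            y ^ {m ∈ nontrivialMaximals F n | ¬ J ≤ m.asIdeal}.card :=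
          Finset.sum_le_sum fun J _ =>
            ncard_badMultipliers_le_pow hR hσ hθ h0 h1 hent hB0 hB J
      _ ≤ D.ncard * (8 * (n : ℝ) ^ 2 * y) := by
          grw [← Finset.mul_sum, hsum]
          exact le_of_eq (by ring)
  nlinarith

end UnionBound

section HermitianSelfDualExistence

variable {F : Type*} [Field F] [Fintype F] {n : ℕ}

theorem natCast_ne_zero_of_coprime_card (hn : n.Coprime (Fintype.card F)) : (n : F) ≠ 0 := by
  intro h
  have hcop : IsCoprime (n : F) (Fintype.card F : F) := hn.cast
  rw [h, FiniteField.cast_card_eq_zero] at hcop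
  exact not_isCoprime_zero_zero hcop

theorem exists_isUnit_cycStar_sub (p h : ℕ) [Fact p.Prime] [CharP F p]
    (hF : Fintype.card F = p ^ h * p ^ h) :
    ∃ θ : CycAlg F n, IsUnit (cycStar p h n θ - θ) := by
  have hQ : 1 < p ^ h := Nat.mul_self_lt_mul_self_iff.1 (hF ▸ Fintype.one_lt_card)
  obtain ⟨c, hc⟩ := exists_pow_ne_self hQ (hF ▸ lt_mul_self hQ)
  refine ⟨AdjoinRoot.of _ c, ?_⟩
  rw [cycStar_of, ← map_sub]
  exact (IsUnit.mk0 _ (sub_ne_zero.2 hc)).map _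

theorem exists_mul_cycStar_eq_neg_one (p h : ℕ) [Fact p.Prime] [CharP F p]
    (hF : Fintype.card F = p ^ h * p ^ h) :
    ∃ g : CycAlg F n, g * cycStar p h n g = -1 := by
  obtain ⟨c, hc⟩ := exists_pow_add_one_eq_neg_one hF
  refine ⟨AdjoinRoot.of _ c, ?_⟩
  rw [cycStar_of, ← map_mul, ← pow_succ', hc, map_neg, map_one]

theorem exists_mul_cycStar_eq_neg_one_lt_relMinDistance [DecidableEq F] (p h : ℕ) [Fact p.Prime]
    [CharP F p] (hF : Fintype.card F = p ^ h * p ^ h) (hn : n.Prime)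
    (hcop : n.Coprime (Fintype.card F)) {δ : ℝ} (h0 : 0 < δ)
    (h1 : δ ≤ 1 - (Fintype.card F : ℝ)⁻¹) (hent : qEntropy (Fintype.card F) δ ≤ 1 / 4) {B : ℕ}
    (hB : B ≤ Fintype.card F ^ orderOf (Fintype.card F : ZMod n)) (hBn : 4 * n ≤ B)
    (hB8 : 8 * (n : ℝ) ^ 2 * (B : ℝ) ^ (-(1 / 2 - 2 * qEntropy (Fintype.card F) δ)) < 1) :
    ∃ g : CycAlg F n, g * cycStar p h n g = -1 ∧ δ < relMinDistance (pairCode 1 g) := by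
  have : NeZero n := ⟨hn.ne_zero⟩
  have := Fintype.ofFinite (MaximalSpectrum (CycAlg F n))
  have := CycAlg.isReduced (natCast_ne_zero_of_coprime_card hcop)
  have hF4 : 4 ≤ Nat.card F := by
    have hQ : 1 < p ^ h := Nat.mul_self_lt_mul_self_iff.1 (hF ▸ Fintype.one_lt_card)
    rw [Nat.card_eq_fintype_card, hF]
    exact Nat.mul_le_mul hQ hQ
  have hquotient : ∀ m ∈ nontrivialMaximals F n, B ≤ Nat.card (CycAlg F n ⧸ m.asIdeal) := by
    intro m hm
    have := Quotient.finite (Submodule.quotientRel m.asIdeal)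
    rw [← Nat.card_eq_fintype_card] at hB
    exact hB.trans
      (CycAlg.pow_orderOf_le_card_quotient hn m.isMaximal (mem_nontrivialMaximals.1 hm))
  obtain ⟨θ, hθ⟩ := exists_isUnit_cycStar_sub (n := n) p h hF
  obtain ⟨g, hg, hdist⟩ := exists_mul_map_eq_neg_one_forall_lt_hammingNorm
    (sum_inv_card_quotient_le hF4 hBn hquotient) (cycStar_involutive p h hF) hθ
    (exists_mul_cycStar_eq_neg_one p h hF) h0 h1 hent (by have := hn.pos; lia) hquotient hB8
  exact ⟨g, hg, lt_relMinDistance (pairCode_one_ne_bot g) hdist⟩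

end HermitianSelfDualExistence

theorem eight_mul_sq_mul_rpow_neg_lt_one {n A B : ℕ} {κ : ℝ} (hn : 8 < n) (hκ : 0 ≤ κ)
    (hA : 3 ≤ A * κ) (hB : n ^ A ≤ B) : 8 * (n : ℝ) ^ 2 * (B : ℝ) ^ (-κ) < 1 := by
  have hn' : (8 : ℝ) < n := by exact_mod_cast hn
  have hn0 : (0 : ℝ) < n := by linarith
  calc 8 * (n : ℝ) ^ 2 * (B : ℝ) ^ (-κ)
      ≤ 8 * (n : ℝ) ^ 2 * ((n : ℝ) ^ A) ^ (-κ) := by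
        gcongr 8 * (n : ℝ) ^ 2 * ?_
        exact Real.rpow_le_rpow_of_nonpos (by positivity) (by exact_mod_cast hB) (by linarith)
    _ = 8 * (n : ℝ) ^ 2 * (n : ℝ) ^ (-(A * κ)) := by
        rw [← Real.rpow_natCast_mul hn0.le, mul_neg]
    _ ≤ 8 * (n : ℝ) ^ 2 * (n : ℝ) ^ (-(3 : ℕ) : ℝ) := by
        gcongr
        · linarith
        · exact_mod_cast hA
    _ = 8 / n := by
        rw [Real.rpow_neg hn0.le, Real.rpow_natCast]
        field_simp
    _ < 1 := (div_lt_one hn0).2 hn'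

theorem exists_prime_eight_mul_sq_mul_rpow_neg_lt_one {q : ℕ} (hq : 2 ≤ q) {κ : ℝ} (hκ : 0 < κ)
    (N : ℕ) : ∃ n : ℕ, n.Prime ∧ N < n ∧ 4 * n ≤ q ^ orderOf (q : ZMod n) ∧
      8 * (n : ℝ) ^ 2 * ((q ^ orderOf (q : ZMod n) : ℕ) : ℝ) ^ (-κ) < 1 := by
  let A := ⌈3 / κ⌉₊ + 2
  have hA : 3 ≤ A * κ := by
    rw [← div_le_iff₀ hκ]
    exact (Nat.le_ceil _).trans (by exact_mod_cast Nat.le_add_right _ 2)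
  obtain ⟨n, hn, hN, hnA⟩ := exists_prime_pow_le_pow_orderOf hq A (N + 8)
  refine ⟨n, hn, by lia, ?_, eight_mul_sq_mul_rpow_neg_lt_one (by lia) hκ.le hA hnA⟩
  calc 4 * n ≤ n * n := Nat.mul_le_mul_right n (by lia)
    _ = n ^ 2 := (sq n).symm
    _ ≤ n ^ A := Nat.pow_le_pow_right hn.pos (Nat.le_add_left 2 _)
    _ ≤ q ^ orderOf (q : ZMod n) := hnA

theorem mainTheorem3 (p ℓ : ℕ) [Fact p.Prime] (hℓ : Even ℓ)
    (F : Type*) [Field F] [Fintype F] [DecidableEq F] [CharP F p]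
    (hF : Fintype.card F = p ^ ℓ)
    (δ : ℝ) (hδ_pos : 0 < δ) (hδ_lt : δ < 1 - ((p ^ ℓ : ℕ) : ℝ)⁻¹)
    (hδ_entropy : qEntropy (p ^ ℓ) δ < 1 / 4) :
    ∃ (n : ℕ → ℕ) (g : ∀ i, CycAlg F (n i))
      (C : ∀ i, Submodule F (Fin (n i) ⊕ Fin (n i) → F)),
      Filter.Tendsto (fun i => 2 * n i) Filter.atTop Filter.atTop ∧
      ∀ i, 1 < n i ∧ (n i).Coprime (p ^ ℓ) ∧
        g i * cycStar p (ℓ / 2) (n i) (g i) = -1 ∧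
        C i = pairCode 1 (g i) ∧
        IsTwoQuasiCyclic (C i) ∧
        IsHermitianSelfDual p ℓ (C i) ∧
        codeRate (C i) = 1 / 2 ∧
        δ < relMinDistance (C i) := by
  have hsq : Fintype.card F = p ^ (ℓ / 2) * p ^ (ℓ / 2) := by
    rw [hF, ← pow_add, ← two_mul, Nat.two_mul_div_two_of_even hℓ]
  rw [← hF] at hδ_lt hδ_entropy ⊢
  choose n hprime hlt hfour height using fun i =>
    exists_prime_eight_mul_sq_mul_rpow_neg_lt_one (Fintype.one_lt_card (α := F))
      (show 0 < 1 / 2 - 2 * qEntropy (Fintype.card F) δ by linarith) (i + Fintype.card F)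
  have hcop (i : ℕ) : (n i).Coprime (Fintype.card F) :=
    Nat.coprime_of_lt_prime Fintype.card_ne_zero (by have := hlt i; lia) (hprime i)
  choose g hg hdist using fun i =>
    exists_mul_cycStar_eq_neg_one_lt_relMinDistance p (ℓ / 2) hsq (hprime i) (hcop i) hδ_pos
      hδ_lt.le hδ_entropy.le le_rfl (hfour i) (height i)
  refine ⟨n, g, fun i => pairCode 1 (g i), ?_, fun i => ?_⟩
  · exact Filter.tendsto_atTop_mono (fun i => (by have := hlt i; lia : i ≤ 2 * n i))
      Filter.tendsto_id
  · have : NeZero (n i) := ⟨(hprime i).ne_zero⟩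
    exact ⟨(hprime i).one_lt, hcop i, hg i, rfl, isTwoQuasiCyclic_pairCode _,
      isGaloisSelfDual_pairCode p (ℓ / 2) hsq (hg i), codeRate_pairCode_one _, hdist i⟩
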